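/- **Setting.** Let $(\overline M,\overline g)$ be a smooth semi-Riemannian manifold of constant index and constant sectional curvature $c$, with Levi-Civita connection $\overline\nabla$, and let $f:M\to\overline M$ be an immersed lightlike hypersurface, i.e. $\dim\overline M=\dim M+1$ and the radical $\mathrm{Rad}\,T_uM=\{x\in T_uM: g(x,y)=0\ \forall y\in T_uM\}$ of the induced metric $g=f^*\overline g$ has dimension $1$ for every $u\in M$. A *screen distribution* $S(TM)$ is a smooth distribution on $M$ with $TM=\mathrm{Rad}\,TM\oplus S(TM)$. A *normalizing pair* of $S(TM)$ on an open set $U\subset M$ consists of a smooth section $\xi$ of $\mathrm{Rad}\,TM$ and a smooth section $N$ of $f^*T\overline M$ over $U$ with $$\overline g(\xi,N)=1,\qquad \overline g(N,N)=0,\qquad \overline g(N,W)=0\ \text{ for all } W\in S(TM).$$ The Gauss and Weingarten formulas $$\overline\nabla_XY=\nabla_XY+B(X,Y)N,\qquad \overline\nabla_XN=-A_NX+\tau(X)N$$ (with $\nabla_XY$, $A_NX$ tangent to $M$) define the induced connection $\nabla$, the local second fundamental form $B$ and the shape operator $A_N$. Let $R(X,Y)=\nabla_X\nabla_Y-\nabla_Y\nabla_X-\nabla_{[X,Y]}$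 and $R(X,Y,Z,T)=g(R(X,Y)Z,T)$. The curvature $R$ and the vector field $A_N\xi$ depend only on $S(TM)$, not on the pair $\{\xi,N\}$. * $S(TM)$ is *admissible* if at every point $R(x,y,z,w)=-R(y,x,z,w)=R(z,w,x,y)$ and $R(x,y,z,w)+R(y,z,x,w)+R(z,x,y,w)=0$. * For an admissible screen and $x\in T_uM$, the *pseudo-Jacobi operator* $J_R(x)$ is the linear map of $T_uM$ given by $\tilde g(J_R(x)y,w)=R(y,x,x,w)$ for all $y,w$, where $\tilde g=g+\eta\otimes\eta$ and $\eta=\overline g(\cdot,N)$. $M$ is *timelike* (resp. *spacelike*) *Osserman at* $u$ if for each admissible screen the characteristic polynomial of $J_R(x)$ is the same for all $x\in T_uM$ with $g(x,x)=-1$ (resp. $g(x,x)=1$). $M$ is *pointwise Osserman* if at each $u\in M$ it is timelike or spacelike Osserman. * $(M,g,S(TM))$ is *semi-symmetric* if for all $V_1,V_2,X,Y,Z,T$ tangent to $M$ $$-R(R(V_1,V_2)X,Y,Z,T)-R(X,R(V_1,V_2)Y,Z,T)-R(X,Y,R(V_1,V_2)Z,T)-R(X,Y,Z,R(V_1,V_2)T)=0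 .$$ * It is *totally geodesic* if $B=0$ identically, i.e. the second fundamental form $h=B\otimes N$ vanishes. **Theorem 5.3.** Let $M$ be a pointwise Osserman lightlike hypersurface of a semi-Riemannian manifold of constant sectional curvature, and let $S(TM)$ be an admissible screen distribution on $M$ such that $A_N\xi$ is non-null, that is, $g(A_N\xi,A_N\xi)\neq 0$ at every point of $M$. Then $(M,g,S(TM))$ is semi-symmetric if and only if it is totally geodesic. -/

import Mathlib

open scoped Manifold ContDiff Bundle Topology

noncomputable section

namespace Lightlike

/-! ### Coordinate formulas -/

section Coordinates

variable {E : Type*} [NormedAddCommGroup E] [NormedSpace ℝ E]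
  {E' : Type*} [NormedAddCommGroup E'] [NormedSpace ℝ E']

/-- The pullback `(v, w) ↦ b(A v, A w)` of a bilinear form. -/
def pullbackForm (b : E' →L[ℝ] E' →L[ℝ] ℝ) (A : E →L[ℝ] E') : E →L[ℝ] E →L[ℝ] ℝ :=
  b.bilinearComp A A

/-- The Christoffel symbols of the Levi-Civita connection of a metric `G` given in coordinates.
`christoffel G y v w` is the value at `y` of `∇_v ∂_w`, where `∂_w` is the constant vector field
`w`; it is the vector `Γ` determined by the Koszul formula
`2 G(Γ, z) = ∂_v G(w, z) + ∂_w G(v, z) - ∂_z G(v, w)` for all `z`.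
(The inverse of `G y : E → E*` raises the index.) -/
def christoffel (G : E → E →L[ℝ] E →L[ℝ] ℝ) (y v w : E) : E :=
  (G y).inverse
    ((2⁻¹ : ℝ) • (fderiv ℝ G y v w + fderiv ℝ G y w v - ((fderiv ℝ G y).flip v).flip w))

/-- The curvature operator `R(v, w) z = ∇_v ∇_w ∂_z - ∇_w ∇_v ∂_z` at `y` of the connection with
Christoffel symbols `Γ y v w = ∇_v ∂_w`, for constant (hence commuting) fields `v`, `w`, `z`. -/
def curvatureOf (Γ : E → E → E → E) (y v w z : E) : E :=
  fderiv ℝ (fun y' => Γ y' w z) y v - fderiv ℝ (fun y' => Γ y' v z) y w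
    + Γ y v (Γ y w z) - Γ y w (Γ y v z)

/-- The ambient covariant derivative `∇̄_v V` at `y` of a vector field `V` along the map `F`,
with respect to the Levi-Civita connection of `G`. -/
def covAlong (G : E' → E' →L[ℝ] E' →L[ℝ] ℝ) (F V : E → E') (y v : E) : E' :=
  fderiv ℝ V y v + christoffel G (F y) (fderiv ℝ F y v) (V y)

/-- The decomposition `V = dF(X) + a n` of an ambient vector `V` at `F y` into a tangential part
and a multiple of a vector `n` that is transversal to the hypersurface `F`; the result is the pair
`(X, a)`. -/
def decomp (F : E → E') (n : E') (y : E) (V : E') : E × ℝ :=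
  ((fderiv ℝ F y).coprod (ContinuousLinearMap.toSpanSingleton ℝ n)).inverse V

/-- Gauss formula, tangential part: the Christoffel symbols of the connection induced on the
hypersurface `F` by the transversal field `n`, from `∇̄_v dF(w) = dF(∇_v w) + B(v, w) n`. -/
def inducedChristoffel (G : E' → E' →L[ℝ] E' →L[ℝ] ℝ) (F n : E → E') (y v w : E) : E :=
  (decomp F (n y) y (covAlong G F (fun y' => fderiv ℝ F y' w) y v)).1

/-- Gauss formula, transversal part: the local second fundamental form `B(v, w)`. -/
def localSecondForm (G : E' → E' →L[ℝ] E' →L[ℝ] ℝ) (F n : E → E') (y v w : E) : ℝ :=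
  (decomp F (n y) y (covAlong G F (fun y' => fderiv ℝ F y' w) y v)).2

/-- Weingarten formula: the shape operator `A_n`, from `∇̄_v n = - dF(A_n v) + τ(v) n`. -/
def localShape (G : E' → E' →L[ℝ] E' →L[ℝ] ℝ) (F n : E → E') (y v : E) : E :=
  -(decomp F (n y) y (covAlong G F n y v)).1

end Coordinates

/-! ### Semi-Riemannian manifolds -/

section Ambient

/-- A (smooth) semi-Riemannian metric of constant index on the manifold `N`. -/
structure SemiRiemannianMetric (E : Type*) [NormedAddCommGroup E] [NormedSpace ℝ E]
    (N : Type*) [TopologicalSpace N] [ChartedSpace E N] [IsManifold 𝓘(ℝ, E) ∞ N] where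
  /-- the bilinear form on each tangent space -/
  val : ∀ x : N, TangentSpace 𝓘(ℝ, E) x →L[ℝ] TangentSpace 𝓘(ℝ, E) x →L[ℝ] ℝ
  symm : ∀ (x : N) (v w : TangentSpace 𝓘(ℝ, E) x), val x v w = val x w v
  nondegenerate : ∀ (x : N) (v : TangentSpace 𝓘(ℝ, E) x), (∀ w, val x v w = 0) → v = 0
  contMDiff : ContMDiff 𝓘(ℝ, E) (𝓘(ℝ, E).prod 𝓘(ℝ, E →L[ℝ] E →L[ℝ] ℝ)) ∞
    (fun x : N => Bundle.TotalSpace.mk' (E →L[ℝ] E →L[ℝ] ℝ)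
      (E := fun x : N => TangentSpace 𝓘(ℝ, E) x →L[ℝ] TangentSpace 𝓘(ℝ, E) x →L[ℝ] ℝ) x (val x))
  /-- the constant index: the maximal dimension of a negative definite subspace -/
  index : ℕ
  index_spec : ∀ x : N, IsGreatest {d : ℕ | ∃ W : Submodule ℝ (TangentSpace 𝓘(ℝ, E) x),
    Module.finrank ℝ W = d ∧ ∀ w ∈ W, w ≠ 0 → val x w w < 0} index

variable {E : Type*} [NormedAddCommGroup E] [NormedSpace ℝ E]
  {N : Type*} [TopologicalSpace N] [ChartedSpace E N] [IsManifold 𝓘(ℝ, E) ∞ N]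

/-- The metric in the preferred chart at `x`, as a function of the coordinates. -/
def metricInChart (g : SemiRiemannianMetric E N) (x : N) (y : E) : E →L[ℝ] E →L[ℝ] ℝ :=
  pullbackForm (E := E) (E' := E) (g.val ((extChartAt 𝓘(ℝ, E) x).symm y))
    (mfderiv 𝓘(ℝ, E) 𝓘(ℝ, E) (extChartAt 𝓘(ℝ, E) x).symm y)

/-- The Riemann curvature operator `R̄(v, w) z` of the Levi-Civita connection at `x`, computed in
the preferred chart at `x`. (In Mathlib a vector of `TangentSpace 𝓘(ℝ, E) x` is the element of `E`
formed by its components in that chart.) -/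
def riemann (g : SemiRiemannianMetric E N) (x : N) (v w z : TangentSpace 𝓘(ℝ, E) x) :
    TangentSpace 𝓘(ℝ, E) x :=
  curvatureOf (E := E) (christoffel (metricInChart g x)) (extChartAt 𝓘(ℝ, E) x x) v w z

/-- All nondegenerate tangent planes (those spanned by `v`, `w` with
`g(v,v) g(w,w) - g(v,w)² ≠ 0`) have sectional curvature `c`. -/
def HasConstantSectionalCurvature (g : SemiRiemannianMetric E N) (c : ℝ) : Prop :=
  ∀ (x : N) (v w : TangentSpace 𝓘(ℝ, E) x),
    g.val x v v * g.val x w w - g.val x v w ^ 2 ≠ 0 →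
    g.val x (riemann g x v w w) v / (g.val x v v * g.val x w w - g.val x v w ^ 2) = c

end Ambient

/-! ### Lightlike hypersurfaces -/

section Hypersurface

variable {E : Type*} [NormedAddCommGroup E] [NormedSpace ℝ E]
  {M : Type*} [TopologicalSpace M] [ChartedSpace E M] [IsManifold 𝓘(ℝ, E) ∞ M]
  {E' : Type*} [NormedAddCommGroup E'] [NormedSpace ℝ E']
  {N : Type*} [TopologicalSpace N] [ChartedSpace E' N] [IsManifold 𝓘(ℝ, E') ∞ N]

/-- The induced (possibly degenerate) metric `f^* g` on `M`. -/
def inducedMetric (g : SemiRiemannianMetric E' N) (f : M → N) (u : M) :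
    TangentSpace 𝓘(ℝ, E) u →L[ℝ] TangentSpace 𝓘(ℝ, E) u →L[ℝ] ℝ :=
  pullbackForm (E := E) (E' := E') (g.val (f u)) (mfderiv 𝓘(ℝ, E) 𝓘(ℝ, E') f u)

/-- The radical `Rad T_u M = T_u M ∩ (T_u M)^⊥` of the induced metric. -/
def radical (g : SemiRiemannianMetric E' N) (f : M → N) (u : M) :
    Submodule ℝ (TangentSpace 𝓘(ℝ, E) u) where
  carrier := {x | ∀ y, inducedMetric g f u x y = 0}
  add_mem' := by
    intro a b ha hb y
    rw [map_add, add_apply, ha y, hb y, add_zero]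
  zero_mem' := by
    intro y
    rw [map_zero, zero_apply]
  smul_mem' := by
    intro r a ha y
    rw [map_smul, smul_apply, ha y, smul_zero]

/-- `f` is an immersion of `M` as a lightlike hypersurface of `(N, g)`: it has codimension one and
the radical of the induced metric has rank one. -/
structure IsLightlikeHypersurface (g : SemiRiemannianMetric E' N) (f : M → N) : Prop where
  contMDiff : ContMDiff 𝓘(ℝ, E) 𝓘(ℝ, E') ∞ f
  injective_mfderiv : ∀ u : M, Function.Injective (mfderiv 𝓘(ℝ, E) 𝓘(ℝ, E') f u)
  codim_one : Module.finrank ℝ E' = Module.finrank ℝ E + 1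
  finrank_radical : ∀ u : M, Module.finrank ℝ (radical (E := E) g f u) = 1

/-- A screen distribution `S(TM)`: a smooth distribution complementary to the radical distribution
in `TM`. (The induced metric is then automatically nondegenerate on it, and the sum orthogonal.) -/
structure Screen (g : SemiRiemannianMetric E' N) (f : M → N) where
  /-- the subspace of the tangent space at each point -/
  space : ∀ u : M, Submodule ℝ (TangentSpace 𝓘(ℝ, E) u)
  isCompl : ∀ u : M, IsCompl (radical g f u) (space u)
  smooth : ∀ u : M, ∃ U : Set M, IsOpen U ∧ u ∈ U ∧
    ∃ (k : ℕ) (W : Fin k → ∀ p : M, TangentSpace 𝓘(ℝ, E) p),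
      (∀ i, ContMDiffOn 𝓘(ℝ, E) 𝓘(ℝ, E).tangent ∞
        (fun p => (⟨p, W i p⟩ : TangentBundle 𝓘(ℝ, E) M)) U) ∧
      ∀ p ∈ U, LinearIndependent ℝ (fun i => W i p) ∧
        Submodule.span ℝ (Set.range fun i => W i p) = space p

/-- A normalizing pair `{ξ, N}` of the screen `S` on the open set `U`: a smooth section `ξ` of
`Rad TM` and a smooth section `ν` of `f^* TN` over `U` with `ν ⟂ S(TM)`, `g(ξ, ν) = 1`,
`g(ν, ν) = 0`. The field `ν` spans the lightlike transversal bundle `ltr(TM) = tr(TM)` over `U`. -/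
structure IsNormalizingPair {g : SemiRiemannianMetric E' N} {f : M → N} (S : Screen (E := E) g f)
    (U : Set M) (ξ : ∀ p : M, TangentSpace 𝓘(ℝ, E) p)
    (ν : ∀ p : M, TangentSpace 𝓘(ℝ, E') (f p)) : Prop where
  isOpen : IsOpen U
  smooth_rad : ContMDiffOn 𝓘(ℝ, E) 𝓘(ℝ, E).tangent ∞
    (fun p => (⟨p, ξ p⟩ : TangentBundle 𝓘(ℝ, E) M)) U
  smooth_trans : ContMDiffOn 𝓘(ℝ, E) 𝓘(ℝ, E').tangent ∞
    (fun p => (⟨f p, ν p⟩ : TangentBundle 𝓘(ℝ, E') N)) U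
  mem_radical : ∀ p ∈ U, ξ p ∈ radical g f p
  pairing : ∀ p ∈ U, g.val (f p) (mfderiv 𝓘(ℝ, E) 𝓘(ℝ, E') f p (ξ p)) (ν p) = 1
  null : ∀ p ∈ U, g.val (f p) (ν p) (ν p) = 0
  orthogonal : ∀ p ∈ U, ∀ w ∈ S.space p,
    g.val (f p) (mfderiv 𝓘(ℝ, E) 𝓘(ℝ, E') f p w) (ν p) = 0

/-- The immersion `f` in the preferred charts at `u` and at `f u`. -/
def mapInChart (f : M → N) (u : M) : E → E' :=
  writtenInExtChartAt 𝓘(ℝ, E) 𝓘(ℝ, E') u f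

/-- A vector field `ν` along `f`, in the preferred charts at `u` and at `f u`. -/
def alongInChart (f : M → N) (ν : ∀ p : M, TangentSpace 𝓘(ℝ, E') (f p)) (u : M) (y : E) : E' :=
  mfderiv 𝓘(ℝ, E') 𝓘(ℝ, E') (extChartAt 𝓘(ℝ, E') (f u))
    (f ((extChartAt 𝓘(ℝ, E) u).symm y)) (ν ((extChartAt 𝓘(ℝ, E) u).symm y))

/-- The curvature operator `R(x, y) z` at `u` of the connection induced on `M` by the Levi-Civita
connection of `g` and the transversal bundle spanned by `ν`. -/
def inducedCurvature (g : SemiRiemannianMetric E' N) (f : M → N)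
    (ν : ∀ p : M, TangentSpace 𝓘(ℝ, E') (f p)) (u : M) (x y z : TangentSpace 𝓘(ℝ, E) u) :
    TangentSpace 𝓘(ℝ, E) u :=
  curvatureOf (E := E) (inducedChristoffel (metricInChart g (f u)) (mapInChart f u) (alongInChart f ν u))
    (extChartAt 𝓘(ℝ, E) u u) x y z

/-- The `(0,4)` curvature `R(x, y, z, w) = g(R(x, y) z, w)` of the induced connection. -/
def inducedCurvature₄ (g : SemiRiemannianMetric E' N) (f : M → N)
    (ν : ∀ p : M, TangentSpace 𝓘(ℝ, E') (f p)) (u : M) (x y z w : TangentSpace 𝓘(ℝ, E) u) : ℝ :=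
  inducedMetric g f u (inducedCurvature g f ν u x y z) w

/-- The local second fundamental form `B(x, y)` at `u` relative to `ν`: `h(x, y) = B(x, y) ν`. -/
def secondForm (g : SemiRiemannianMetric E' N) (f : M → N)
    (ν : ∀ p : M, TangentSpace 𝓘(ℝ, E') (f p)) (u : M) (x y : TangentSpace 𝓘(ℝ, E) u) : ℝ :=
  localSecondForm (E := E) (metricInChart g (f u)) (mapInChart f u) (alongInChart f ν u)
    (extChartAt 𝓘(ℝ, E) u u) x y

/-- The shape operator `A_ν x` at `u`. -/
def shape (g : SemiRiemannianMetric E' N) (f : M → N)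
    (ν : ∀ p : M, TangentSpace 𝓘(ℝ, E') (f p)) (u : M) (x : TangentSpace 𝓘(ℝ, E) u) :
    TangentSpace 𝓘(ℝ, E) u :=
  localShape (E := E) (metricInChart g (f u)) (mapInChart f u) (alongInChart f ν u)
    (extChartAt 𝓘(ℝ, E) u u) x

/-- `R` is an algebraic curvature tensor on `V`. -/
def IsAlgebraicCurvature {V : Type*} (R : V → V → V → V → ℝ) : Prop :=
  (∀ x y z w, R x y z w = -R y x z w) ∧ (∀ x y z w, R x y z w = R z w x y) ∧
    ∀ x y z w, R x y z w + R y z x w + R z x y w = 0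

/-- The screen is admissible: its induced curvature is an algebraic curvature tensor at each
point. (The induced curvature does not depend on the choice of the normalizing pair.) -/
def Screen.IsAdmissible {g : SemiRiemannianMetric E' N} {f : M → N} (S : Screen (E := E) g f) :
    Prop :=
  ∀ U ξ ν, IsNormalizingPair S U ξ ν → ∀ u ∈ U,
    IsAlgebraicCurvature (inducedCurvature₄ (E := E) g f ν u)

/-- The nondegenerate metric `g̃ = g + η ⊗ η` associated with a normalizing pair, where
`η(x) = g(x, ν)`. -/
def associatedMetric (g : SemiRiemannianMetric E' N) (f : M → N)
    (ν : ∀ p : M, TangentSpace 𝓘(ℝ, E') (f p)) (u : M) (x y : TangentSpace 𝓘(ℝ, E) u) : ℝ :=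
  inducedMetric g f u x y +
    g.val (f u) (mfderiv 𝓘(ℝ, E) 𝓘(ℝ, E') f u x) (ν u) *
      g.val (f u) (mfderiv 𝓘(ℝ, E) 𝓘(ℝ, E') f u y) (ν u)

/-- `J` is the pseudo-Jacobi operator `J_R(x)` on `T_u M`, the linear map characterized by
`g̃(J y, w) = R(y, x, x, w)` for all `y`, `w`. -/
def IsPseudoJacobi (g : SemiRiemannianMetric E' N) (f : M → N)
    (ν : ∀ p : M, TangentSpace 𝓘(ℝ, E') (f p)) (u : M) (x : TangentSpace 𝓘(ℝ, E) u)
    (J : TangentSpace 𝓘(ℝ, E) u →ₗ[ℝ] TangentSpace 𝓘(ℝ, E) u) : Prop :=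
  ∀ y w, associatedMetric g f ν u (J y) w = inducedCurvature₄ g f ν u y x x w

section FiniteDim

variable [FiniteDimensional ℝ E]

/-- For each admissible screen, the characteristic polynomial of `J_R(x)` is the same for all
`x ∈ T_u M` with `g(x, x) = ε`. For `ε = -1` this says that `M` is timelike Osserman at `u`, for
`ε = 1` that it is spacelike Osserman at `u`. -/
def IsOssermanAt (g : SemiRiemannianMetric E' N) (f : M → N) (ε : ℝ) (u : M) : Prop :=
  ∀ S : Screen (E := E) g f, S.IsAdmissible → ∀ U ξ ν, IsNormalizingPair S U ξ ν → u ∈ U →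
    ∀ x x' : TangentSpace 𝓘(ℝ, E) u,
      inducedMetric g f u x x = ε → inducedMetric g f u x' x' = ε →
      ∀ J J' : E →ₗ[ℝ] E, IsPseudoJacobi g f ν u x J → IsPseudoJacobi g f ν u x' J' →
        J.charpoly = J'.charpoly

/-- `M` is pointwise Osserman: at each point it is timelike or spacelike Osserman. -/
def IsPointwiseOsserman (g : SemiRiemannianMetric E' N) (f : M → N) : Prop :=
  ∀ u : M, IsOssermanAt (E := E) g f (-1) u ∨ IsOssermanAt (E := E) g f 1 u

end FiniteDim

/-- `A_N ξ` is a non-null vector field: `g(A_N ξ, A_N ξ) ≠ 0` at each point. (The vector `A_N ξ`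
does not depend on the choice of the normalizing pair `{ξ, N}` of the screen.) -/
def Screen.IsNonNullShape {g : SemiRiemannianMetric E' N} {f : M → N} (S : Screen (E := E) g f) :
    Prop :=
  ∀ U ξ ν, IsNormalizingPair S U ξ ν → ∀ u ∈ U,
    inducedMetric g f u (shape g f ν u (ξ u)) (shape g f ν u (ξ u)) ≠ 0

/-- `(M, g, S(TM))` is semi-symmetric: `R(v₁, v₂) · R = 0` for the `(0,4)` induced curvature. -/
def Screen.IsSemiSymmetric {g : SemiRiemannianMetric E' N} {f : M → N}
    (S : Screen (E := E) g f) : Prop :=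
  ∀ U ξ ν, IsNormalizingPair S U ξ ν → ∀ u ∈ U, ∀ v₁ v₂ x y z t : TangentSpace 𝓘(ℝ, E) u,
    - inducedCurvature₄ g f ν u (inducedCurvature g f ν u v₁ v₂ x) y z t
    - inducedCurvature₄ g f ν u x (inducedCurvature g f ν u v₁ v₂ y) z t
    - inducedCurvature₄ g f ν u x y (inducedCurvature g f ν u v₁ v₂ z) t
    - inducedCurvature₄ g f ν u x y z (inducedCurvature g f ν u v₁ v₂ t) = 0

/-- `(M, g, S(TM))` is totally geodesic: its second fundamental form `h = B ⊗ N` vanishes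
identically. -/
def Screen.IsTotallyGeodesic {g : SemiRiemannianMetric E' N} {f : M → N}
    (S : Screen (E := E) g f) : Prop :=
  ∀ U ξ ν, IsNormalizingPair S U ξ ν → ∀ u ∈ U, ∀ x y : TangentSpace 𝓘(ℝ, E) u,
    secondForm g f ν u x y = 0

end Hypersurface

end Lightlike

end

open Lightlike

/-!
Along a lightlike hypersurface of a space form of curvature `c`, the Gauss equation reads
`R(x, y) z = c (g(y, z) x - g(x, z) y) + B(y, z) A x - B(x, z) A y` for the shape operator `A` of
the transversal field. The radical field `ξ` is null along the hypersurface, so `B(·, ξ) = 0`.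
Pairing the Gauss equation for `x, y, z = ξ, x, y` with `w` leaves `B(x, y) g(A ξ, w)`, while the
pair symmetry of an admissible curvature turns the left-hand side into `g(R(y, w) ξ, x) = 0`.
Hence `B(x, y) g(A ξ, ·) = 0`, and `B = 0` as soon as `A ξ` is not in the radical. Then `R` is
built from `g` alone, and each `R(v₁, v₂)` is skew-adjoint for `g`, hence annihilates `R`.
-/

noncomputable section

namespace Lightlike

set_option maxSynthPendingDepth 3

section AlgebraicCurvature

variable {V : Type*}

theorem pair_symm_of_bianchi {K : V → V → V → V → ℝ}
    (skew_left : ∀ x y z w, K x y z w = -K y x z w)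
    (skew_right : ∀ x y z w, K x y z w = -K x y w z)
    (bianchi : ∀ x y z w, K x y z w + K y z x w + K z x y w = 0) (x y z w : V) :
    K x y z w = K z w x y := by
  -- Milnor's octahedron: combine the Bianchi identities of four of its faces.
  linarith [bianchi x y z w, bianchi y z w x, bianchi z w x y, bianchi w x y z,
    skew_right y z w x, skew_right z w y x, skew_left w y z x, skew_left w x z y,
    skew_right x w z y, skew_left x z w y, skew_right z x w y, skew_left w x y z,
    skew_right x y w z, skew_right y w x z]

theorem IsAlgebraicCurvature.mk_of_skew {K : V → V → V → V → ℝ}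
    (skew_left : ∀ x y z w, K x y z w = -K y x z w)
    (skew_right : ∀ x y z w, K x y z w = -K x y w z)
    (bianchi : ∀ x y z w, K x y z w + K y z x w + K z x y w = 0) : IsAlgebraicCurvature K :=
  ⟨skew_left, pair_symm_of_bianchi skew_left skew_right bianchi, bianchi⟩

/-- The tensor `g(y, z) g(x, w) - g(x, z) g(y, w)`: the curvature of constant sectional
curvature `1` for the form `g`. -/
def spaceFormTensor (g : V → V → ℝ) (x y z w : V) : ℝ :=
  g y z * g x w - g x z * g y w

/-- The Gram determinant of the pair `v, w` for the form `g`; the denominator of the sectional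
curvature, nonzero exactly when `v, w` span a nondegenerate plane. -/
def gramDet (g : V → V → ℝ) (v w : V) : ℝ :=
  g v v * g w w - g v w ^ 2

theorem spaceFormTensor_self {g : V → V → ℝ} (hg : ∀ x y, g x y = g y x) (v w : V) :
    spaceFormTensor g v w w v = gramDet g v w := by
  simp only [spaceFormTensor, gramDet, hg w v]; ring

theorem isAlgebraicCurvature_spaceFormTensor {g : V → V → ℝ} (hg : ∀ x y, g x y = g y x) (c : ℝ) :
    IsAlgebraicCurvature fun x y z w => c * spaceFormTensor g x y z w := by
  simp only [spaceFormTensor]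
  refine ⟨fun x y z w => by ring, fun x y z w => ?_, fun x y z w => ?_⟩
  · dsimp only; rw [hg w x, hg z x, hg z y, hg w y]; ring
  · dsimp only; rw [hg z x, hg z y, hg y x]; ring

theorem spaceFormTensor_derivation_eq_zero {g : V → V → ℝ} {T : V → V}
    (hT : ∀ x y, g (T x) y = -g x (T y)) (x y z w : V) :
    spaceFormTensor g (T x) y z w + spaceFormTensor g x (T y) z w
      + spaceFormTensor g x y (T z) w + spaceFormTensor g x y z (T w) = 0 := by
  simp only [spaceFormTensor, hT]; ring

namespace IsAlgebraicCurvature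

variable {K K' : V → V → V → V → ℝ}

theorem skew_right (hK : IsAlgebraicCurvature K) (x y z w : V) : K x y z w = -K x y w z := by
  rw [hK.2.1, hK.1, hK.2.1 w z]

theorem sub (hK : IsAlgebraicCurvature K) (hK' : IsAlgebraicCurvature K') :
    IsAlgebraicCurvature fun x y z w => K x y z w - K' x y z w :=
  ⟨fun x y z w => by linarith [hK.1 x y z w, hK'.1 x y z w],
    fun x y z w => by linarith [hK.2.1 x y z w, hK'.2.1 x y z w],
    fun x y z w => by linarith [hK.2.2 x y z w, hK'.2.2 x y z w]⟩

variable [AddCommGroup V] [Module ℝ V]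

theorem isLinearMap_snd (hK : IsAlgebraicCurvature K)
    (hlin : ∀ y z w, IsLinearMap ℝ fun x => K x y z w) (x z w : V) :
    IsLinearMap ℝ fun y => K x y z w := by
  simp only [hK.1 x]
  exact ⟨fun y y' => by rw [(hlin x z w).map_add, neg_add],
    fun r y => by rw [(hlin x z w).map_smul, smul_neg]⟩

theorem isLinearMap_trd (hK : IsAlgebraicCurvature K)
    (hlin : ∀ y z w, IsLinearMap ℝ fun x => K x y z w) (x y w : V) :
    IsLinearMap ℝ fun z => K x y z w := by
  simp only [hK.2.1 x y]
  exact hlin w x y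

theorem isLinearMap_fth (hK : IsAlgebraicCurvature K)
    (hlin : ∀ y z w, IsLinearMap ℝ fun x => K x y z w) (x y z : V) :
    IsLinearMap ℝ fun w => K x y z w := by
  simp only [hK.2.1 x y]
  exact hK.isLinearMap_snd hlin z x y

theorem eq_zero_of_sectional_eq_zero (hK : IsAlgebraicCurvature K)
    (hlin : ∀ y z w, IsLinearMap ℝ fun x => K x y z w) (hd : ∀ x y, K x y y x = 0)
    (x y z w : V) : K x y z w = 0 := by
  have add₂ x z w := (hK.isLinearMap_snd hlin x z w).map_add
  have add₃ x y w := (hK.isLinearMap_trd hlin x y w).map_add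
  have add₄ x y z := (hK.isLinearMap_fth hlin x y z).map_add
  have polar : ∀ x y z, K x y z x = 0 := fun x y z => by
    have h := hd x (y + z)
    rw [add₂, add₃, add₃, hd, hd] at h
    linarith [hK.2.1 x z y x, hK.1 y x x z, hK.skew_right x y x z]
  have skew_outer : ∀ x y z w, K x y z w = -K w y z x := fun x y z w => by
    have h := polar (x + w) y z
    rw [(hlin y z (x + w)).map_add, add₄, add₄, polar, polar] at h
    linarith
  have skew_inner : ∀ x y z w, K x y z w = -K x z y w := fun x y z w => by
    linarith [hK.1 x y z w, skew_outer y x z w, hK.skew_right w x z y, skew_outer w x y z,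
      hK.1 z x y w]
  -- `K` is alternating, so the three terms of the Bianchi identity coincide.
  linarith [hK.2.2 x y z w, skew_inner y z x w, hK.1 y x z w, hK.1 z x y w, skew_inner x z y w]

theorem continuous_sectional_line (hK : IsAlgebraicCurvature K)
    (hlin : ∀ y z w, IsLinearMap ℝ fun x => K x y z w) (v w v₀ w₀ : V) :
    Continuous fun t : ℝ => K (v + t • v₀) (w + t • w₀) (w + t • w₀) (v + t • v₀) := by
  simp only [(hlin _ _ _).map_add, (hlin _ _ _).map_smul, (hK.isLinearMap_snd hlin _ _ _).map_add,
    (hK.isLinearMap_snd hlin _ _ _).map_smul, (hK.isLinearMap_trd hlin _ _ _).map_add,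
    (hK.isLinearMap_trd hlin _ _ _).map_smul, (hK.isLinearMap_fth hlin _ _ _).map_add,
    (hK.isLinearMap_fth hlin _ _ _).map_smul, smul_eq_mul]
  fun_prop

end IsAlgebraicCurvature

theorem finite_quartic_eq_zero {a : ℝ} (ha : a ≠ 0) (b c d e : ℝ) :
    {t : ℝ | a * t ^ 4 + b * t ^ 3 + c * t ^ 2 + d * t + e = 0}.Finite := by
  let p : Polynomial ℝ := .C a * .X ^ 4 + .C b * .X ^ 3 + .C c * .X ^ 2 + .C d * .X + .C e
  have hp : p ≠ 0 := fun h => ha (by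
    simpa [p, Polynomial.coeff_X, Polynomial.coeff_C] using congrArg (Polynomial.coeff · 4) h)
  simpa [p, Polynomial.IsRoot.def] using Polynomial.finite_setOfPred_isRoot hp

variable [AddCommGroup V] [Module ℝ V] {K : V → V → V → V → ℝ} {g : LinearMap.BilinForm ℝ V}

theorem finite_gramDet_line_eq_zero (hg : ∀ x y, g x y = g y x) {v₀ w₀ : V}
    (h₀ : gramDet (g · ·) v₀ w₀ ≠ 0) (v w : V) :
    {t : ℝ | gramDet (g · ·) (v + t • v₀) (w + t • w₀) = 0}.Finite := by
  refine (finite_quartic_eq_zero h₀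
    (2 * (g v v₀ * g w₀ w₀ + g v₀ v₀ * g w w₀ - g v₀ w₀ * (g v w₀ + g v₀ w)))
    (g v v * g w₀ w₀ + 4 * (g v v₀ * g w w₀) + g v₀ v₀ * g w w - (g v w₀ + g v₀ w) ^ 2
      - 2 * (g v w * g v₀ w₀))
    (2 * (g v v * g w w₀ + g v v₀ * g w w - g v w * (g v w₀ + g v₀ w)))
    (gramDet (g · ·) v w)).subset fun t ht => ?_
  simp only [gramDet, Set.mem_ofPred_eq, map_add, LinearMap.add_apply, map_smul,
    LinearMap.smul_apply, smul_eq_mul, hg v₀ v, hg w₀ w] at ht ⊢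
  linarith

/-- The planes of nonzero Gram determinant are dense as soon as there is one. -/
theorem IsAlgebraicCurvature.eq_zero_of_sectional_eq_zero_of_gramDet_ne_zero
    (hK : IsAlgebraicCurvature K) (hlin : ∀ y z w, IsLinearMap ℝ fun x => K x y z w)
    (hg : ∀ x y, g x y = g y x) {v₀ w₀ : V} (h₀ : gramDet (g · ·) v₀ w₀ ≠ 0)
    (hd : ∀ v w, gramDet (g · ·) v w ≠ 0 → K v w w v = 0) (x y z w : V) : K x y z w = 0 := by
  refine hK.eq_zero_of_sectional_eq_zero hlin (fun v w => ?_) x y z w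
  have dense := (finite_gramDet_line_eq_zero hg h₀ v w).countable.dense_compl ℝ
  simpa using congrFun ((hK.continuous_sectional_line hlin v w v₀ w₀).ext_on dense
    continuous_const fun t ht => hd _ _ ht) 0

theorem IsAlgebraicCurvature.eq_spaceFormTensor_of_sectional_eq
    (hK : IsAlgebraicCurvature K) (hlin : ∀ y z w, IsLinearMap ℝ fun x => K x y z w)
    (hg : ∀ x y, g x y = g y x) {v₀ w₀ : V} (h₀ : gramDet (g · ·) v₀ w₀ ≠ 0) {c : ℝ}
    (hc : ∀ v w, gramDet (g · ·) v w ≠ 0 → K v w w v / gramDet (g · ·) v w = c) (x y z w : V) :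
    K x y z w = c * spaceFormTensor (g · ·) x y z w := by
  refine sub_eq_zero.1 ((hK.sub (isAlgebraicCurvature_spaceFormTensor hg c)
    ).eq_zero_of_sectional_eq_zero_of_gramDet_ne_zero (fun y z w => ?_) hg h₀
    (fun v w hvw => ?_) x y z w)
  · refine ⟨fun x x' => ?_, fun r x => ?_⟩
    · simp only [(hlin y z w).map_add, spaceFormTensor, map_add, LinearMap.add_apply]; ring
    · simp only [(hlin y z w).map_smul, spaceFormTensor, map_smul, LinearMap.smul_apply,
        smul_eq_mul]
      ring
  · rw [spaceFormTensor_self hg, sub_eq_zero]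
    exact (div_eq_iff hvw).1 (hc v w hvw)

end AlgebraicCurvature

section Calculus

variable {E : Type*} [NormedAddCommGroup E] [NormedSpace ℝ E]
  {F : Type*} [NormedAddCommGroup F] [NormedSpace ℝ F]
  {F' : Type*} [NormedAddCommGroup F'] [NormedSpace ℝ F']

theorem fderiv_clm_apply_apply {c : E → F →L[ℝ] F'} {u : E → F} {x : E}
    (hc : DifferentiableAt ℝ c x) (hu : DifferentiableAt ℝ u x) (v : E) :
    fderiv ℝ (fun y => c y (u y)) x v = c x (fderiv ℝ u x v) + fderiv ℝ c x v (u x) := by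
  rw [fderiv_clm_apply hc hu]; rfl

theorem fderiv_clm_apply_const {c : E → F →L[ℝ] F'} {x : E}
    (hc : DifferentiableAt ℝ c x) (u : F) (v : E) :
    fderiv ℝ (fun y => c y u) x v = fderiv ℝ c x v u := by
  rw [fderiv_clm_apply_apply hc (differentiableAt_const u)]; simp

theorem differentiableAt_fderiv {f : E → F} {x : E} (hf : ContDiffAt ℝ 2 f x) :
    DifferentiableAt ℝ (fderiv ℝ f) x :=
  (hf.fderiv_right (m := 1) (by norm_num)).differentiableAt (by simp)

theorem fderiv_fderiv_symm {f : E → F} {x : E} (hf : ContDiffAt ℝ 2 f x) (v w : E) :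
    fderiv ℝ (fun y => fderiv ℝ f y w) x v = fderiv ℝ (fun y => fderiv ℝ f y v) x w := by
  rw [fderiv_clm_apply_const (differentiableAt_fderiv hf),
    fderiv_clm_apply_const (differentiableAt_fderiv hf)]
  exact (hf.isSymmSndFDerivAt (by simp)).eq v w

theorem eventually_isInvertible [CompleteSpace F] {X : Type*} [TopologicalSpace X]
    {c : X → F →L[ℝ] F'} {x : X} (hc : ContinuousAt c x) (hx : (c x).IsInvertible) :
    ∀ᶠ y in 𝓝 x, (c y).IsInvertible := by
  obtain ⟨e, he⟩ := hx
  exact hc (ContinuousLinearEquiv.isOpen.mem_nhds ⟨e, he⟩)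

end Calculus

section LeviCivita

variable {E : Type*} [NormedAddCommGroup E] [NormedSpace ℝ E]
  {E' : Type*} [NormedAddCommGroup E'] [NormedSpace ℝ E']

/-- `G` is a semi-Riemannian metric near the point `y₀` of a coordinate domain, of the minimal
regularity for which its curvature makes sense. -/
structure IsLocalMetric (G : E' → E' →L[ℝ] E' →L[ℝ] ℝ) (y₀ : E') : Prop where
  contDiffAt : ContDiffAt ℝ 2 G y₀
  symm : ∀ y v w, G y v w = G y w v
  isInvertible : (G y₀).IsInvertible

/-- The Christoffel symbols as a field of continuous bilinear maps, which can be differentiated in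
the base point before its arguments are fixed. -/
def christoffelL (G : E' → E' →L[ℝ] E' →L[ℝ] ℝ) (y : E') : E' →L[ℝ] E' →L[ℝ] E' :=
  (ContinuousLinearMap.compL ℝ E' (E' →L[ℝ] ℝ) E' (G y).inverse) ∘L
    ((2⁻¹ : ℝ) • (fderiv ℝ G y + ContinuousLinearMap.flipₗᵢ ℝ E' E' (E' →L[ℝ] ℝ) (fderiv ℝ G y)
      - (ContinuousLinearMap.flipₗᵢ ℝ E' E' ℝ).toContinuousLinearEquiv.toContinuousLinearMap ∘L
        ContinuousLinearMap.flipₗᵢ ℝ E' E' (E' →L[ℝ] ℝ) (fderiv ℝ G y)))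

theorem christoffel_eq (G : E' → E' →L[ℝ] E' →L[ℝ] ℝ) (y v w : E') :
    christoffel G y v w = christoffelL G y v w := rfl

namespace IsLocalMetric

variable {G : E' → E' →L[ℝ] E' →L[ℝ] ℝ} {y : E'}

theorem differentiableAt (hG : IsLocalMetric G y) : DifferentiableAt ℝ G y :=
  hG.contDiffAt.differentiableAt (by simp)

theorem eventually [CompleteSpace E'] (hG : IsLocalMetric G y) :
    ∀ᶠ y' in 𝓝 y, IsLocalMetric G y' := by
  filter_upwards [hG.contDiffAt.eventually (by simp),
    eventually_isInvertible hG.contDiffAt.continuousAt hG.isInvertible] with y' hc hi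
  exact ⟨hc, hG.symm, hi⟩

theorem differentiableAt_christoffelL [CompleteSpace E'] (hG : IsLocalMetric G y) :
    DifferentiableAt ℝ (christoffelL G) y := by
  have hD := differentiableAt_fderiv hG.contDiffAt
  have hinv : DifferentiableAt ℝ (fun y => (G y).inverse) y :=
    ((hG.isInvertible.contDiffAt_map_inverse (n := 1)).differentiableAt (by simp)).comp y
      hG.differentiableAt
  have hflip : DifferentiableAt ℝ
      (fun y => ContinuousLinearMap.flipₗᵢ ℝ E' E' (E' →L[ℝ] ℝ) (fderiv ℝ G y)) y :=
    (ContinuousLinearMap.flipₗᵢ ℝ E' E' (E' →L[ℝ] ℝ)).differentiableAt.comp y hD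
  exact (((ContinuousLinearMap.compL ℝ E' (E' →L[ℝ] ℝ) E').differentiableAt).comp y hinv).clm_comp
    (((hD.add hflip).sub ((differentiableAt_const _).clm_comp hflip)).const_smul (2⁻¹ : ℝ))

theorem fderiv_symm (hG : IsLocalMetric G y) (t v w : E') :
    fderiv ℝ G y t v w = fderiv ℝ G y t w v := by
  have h : ∀ v w, fderiv ℝ G y t v w = fderiv ℝ (fun y => G y v w) y t := fun v w => by
    rw [fderiv_clm_apply_const (hG.differentiableAt.clm_apply (differentiableAt_const v)),
      fderiv_clm_apply_const hG.differentiableAt]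
  simp only [h, hG.symm _ v w]

theorem christoffel_symm (hG : IsLocalMetric G y) (v w : E') :
    christoffel G y v w = christoffel G y w v := by
  have : ((fderiv ℝ G y).flip v).flip w = ((fderiv ℝ G y).flip w).flip v := by
    ext z; exact hG.fderiv_symm z v w
  rw [christoffel, christoffel, this, add_comm (fderiv ℝ G y v w)]

theorem koszul (hG : IsLocalMetric G y) (v w z : E') :
    G y (christoffel G y v w) z =
      2⁻¹ * (fderiv ℝ G y v w z + fderiv ℝ G y w v z - fderiv ℝ G y z v w) := by
  rw [christoffel, hG.isInvertible.self_apply_inverse]; rfl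

theorem fderiv_eq (hG : IsLocalMetric G y) (v w z : E') :
    fderiv ℝ G y v w z = G y (christoffel G y v w) z + G y w (christoffel G y v z) := by
  rw [hG.symm y w, hG.koszul, hG.koszul, hG.fderiv_symm v z w, hG.fderiv_symm w v z,
    hG.fderiv_symm z v w]
  ring

theorem curvatureOf_eq [CompleteSpace E'] (hG : IsLocalMetric G y) (v w z : E') :
    curvatureOf (christoffel G) y v w z
      = fderiv ℝ (christoffelL G) y v w z - fderiv ℝ (christoffelL G) y w v z
        + christoffel G y v (christoffel G y w z)
        - christoffel G y w (christoffel G y v z) := by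
  have hΓ := hG.differentiableAt_christoffelL
  have h : ∀ v w, fderiv ℝ (fun y' => christoffel G y' w z) y v
      = fderiv ℝ (christoffelL G) y v w z := fun v w => by
    simp only [christoffel_eq]
    rw [fderiv_clm_apply_const (hΓ.clm_apply (differentiableAt_const w)),
      fderiv_clm_apply_const hΓ]
  rw [curvatureOf, h, h]

end IsLocalMetric

section CovAlong

variable {G : E' → E' →L[ℝ] E' →L[ℝ] ℝ} {F V W : E → E'} {y : E}

theorem covAlong_congr (h : V =ᶠ[𝓝 y] W) (v : E) : covAlong G F V y v = covAlong G F W y v := by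
  rw [covAlong, covAlong, h.fderiv_eq, h.eq_of_nhds]

theorem covAlong_add (hV : DifferentiableAt ℝ V y) (hW : DifferentiableAt ℝ W y) (v : E) :
    covAlong G F (fun y' => V y' + W y') y v = covAlong G F V y v + covAlong G F W y v := by
  simp only [covAlong, christoffel_eq, fderiv_fun_add hV hW, add_apply, map_add]
  abel

theorem covAlong_smul {a : E → ℝ} (ha : DifferentiableAt ℝ a y) (hV : DifferentiableAt ℝ V y)
    (v : E) : covAlong G F (fun y' => a y' • V y') y v
      = fderiv ℝ a y v • V y + a y • covAlong G F V y v := by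
  simp only [covAlong, christoffel_eq, fderiv_fun_smul ha hV, add_apply, smul_apply, map_smul,
    ContinuousLinearMap.smulRight_apply]
  module

theorem covAlong_fderiv_apply (hF : ContDiffAt ℝ 2 F y) {X : E → E} (hX : DifferentiableAt ℝ X y)
    (v : E) : covAlong G F (fun y' => fderiv ℝ F y' (X y')) y v
      = fderiv ℝ F y (fderiv ℝ X y v) + covAlong G F (fun y' => fderiv ℝ F y' (X y)) y v := by
  have hD := differentiableAt_fderiv hF
  rw [covAlong, covAlong, fderiv_clm_apply_apply hD hX, fderiv_clm_apply_const hD, add_assoc]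

theorem covAlong_fderiv_symm (hG : IsLocalMetric G (F y)) (hF : ContDiffAt ℝ 2 F y) (v w : E) :
    covAlong G F (fun y' => fderiv ℝ F y' w) y v
      = covAlong G F (fun y' => fderiv ℝ F y' v) y w := by
  rw [covAlong, covAlong, fderiv_fderiv_symm hF, hG.christoffel_symm]

theorem fderiv_metric_apply (hG : IsLocalMetric G (F y)) (hF : DifferentiableAt ℝ F y)
    (hV : DifferentiableAt ℝ V y) (hW : DifferentiableAt ℝ W y) (v : E) :
    fderiv ℝ (fun y' => G (F y') (V y') (W y')) y v
      = G (F y) (covAlong G F V y v) (W y) + G (F y) (V y) (covAlong G F W y v) := by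
  have hGF : DifferentiableAt ℝ (fun y' => G (F y')) y := hG.differentiableAt.comp y hF
  rw [fderiv_clm_apply_apply (hGF.clm_apply hV) hW, fderiv_clm_apply_apply hGF hV,
    fderiv_fun_comp y hG.differentiableAt hF]
  simp only [covAlong, add_apply, map_add, ContinuousLinearMap.comp_apply, hG.fderiv_eq]
  abel

variable [CompleteSpace E']

theorem differentiableAt_covAlong (hG : IsLocalMetric G (F y)) (hF : ContDiffAt ℝ 2 F y)
    (hV : ContDiffAt ℝ 2 V y) (v : E) : DifferentiableAt ℝ (fun y' => covAlong G F V y' v) y := by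
  have hΓF : DifferentiableAt ℝ (fun y' => christoffelL G (F y')) y :=
    hG.differentiableAt_christoffelL.comp y (hF.differentiableAt (by simp))
  simp only [covAlong, christoffel_eq]
  exact ((differentiableAt_fderiv hV).clm_apply (differentiableAt_const v)).add
    ((hΓF.clm_apply ((differentiableAt_fderiv hF).clm_apply (differentiableAt_const v))).clm_apply
      (hV.differentiableAt (by simp)))

theorem fderiv_christoffelL (hG : IsLocalMetric G (F y)) (hF : ContDiffAt ℝ 2 F y)
    (hV : DifferentiableAt ℝ V y) (v w : E) :
    fderiv ℝ (fun y' => christoffelL G (F y') (fderiv ℝ F y' w) (V y')) y v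
      = christoffelL G (F y) (fderiv ℝ F y w) (fderiv ℝ V y v)
        + christoffelL G (F y) (fderiv ℝ (fun y' => fderiv ℝ F y' w) y v) (V y)
        + fderiv ℝ (christoffelL G) (F y) (fderiv ℝ F y v) (fderiv ℝ F y w) (V y) := by
  have dF : DifferentiableAt ℝ F y := hF.differentiableAt (by simp)
  have dFw : DifferentiableAt ℝ (fun y' => fderiv ℝ F y' w) y :=
    (differentiableAt_fderiv hF).clm_apply (differentiableAt_const w)
  have hΓF : DifferentiableAt ℝ (fun y' => christoffelL G (F y')) y :=
    hG.differentiableAt_christoffelL.comp y dF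
  rw [fderiv_clm_apply_apply (hΓF.clm_apply dFw) hV, fderiv_clm_apply_apply hΓF dFw,
    fderiv_fun_comp y hG.differentiableAt_christoffelL dF, add_apply, add_assoc]
  rfl

theorem ricci_identity (hG : IsLocalMetric G (F y)) (hF : ContDiffAt ℝ 2 F y)
    (hV : ContDiffAt ℝ 2 V y) (v w : E) :
    covAlong G F (fun y' => covAlong G F V y' w) y v
        - covAlong G F (fun y' => covAlong G F V y' v) y w
      = curvatureOf (christoffel G) (F y) (fderiv ℝ F y v) (fderiv ℝ F y w) (V y) := by
  have dV : DifferentiableAt ℝ V y := hV.differentiableAt (by simp)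
  have hΓF : DifferentiableAt ℝ (fun y' => christoffelL G (F y')) y :=
    hG.differentiableAt_christoffelL.comp y (hF.differentiableAt (by simp))
  have expand : ∀ v w, covAlong G F (fun y' => covAlong G F V y' w) y v
      = fderiv ℝ (fun y' => fderiv ℝ V y' w) y v
        + fderiv ℝ (fun y' => christoffelL G (F y') (fderiv ℝ F y' w) (V y')) y v
        + christoffelL G (F y) (fderiv ℝ F y v) (covAlong G F V y w) := fun v w => by
    simp only [covAlong, christoffel_eq]
    rw [fderiv_fun_add ((differentiableAt_fderiv hV).clm_apply (differentiableAt_const w))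
      ((hΓF.clm_apply ((differentiableAt_fderiv hF).clm_apply (differentiableAt_const w))).clm_apply
        dV), add_apply]
  rw [hG.curvatureOf_eq, expand, expand, fderiv_fderiv_symm hV v w,
    fderiv_christoffelL hG hF dV, fderiv_christoffelL hG hF dV, fderiv_fderiv_symm hF v w]
  simp only [covAlong, christoffel_eq, map_add]
  abel

end CovAlong

theorem curvatureOf_swap (Γ : E' → E' → E' → E') (y v w z : E') :
    curvatureOf Γ y v w z = -curvatureOf Γ y w v z := by
  simp only [curvatureOf]; abel

theorem curvatureOf_bianchi {Γ : E' → E' → E' → E'} {y : E'}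
    (hΓ : ∀ᶠ y' in 𝓝 y, ∀ v w, Γ y' v w = Γ y' w v) (v w z : E') :
    curvatureOf Γ y v w z + curvatureOf Γ y w z v + curvatureOf Γ y z v w = 0 := by
  have hd : ∀ v w, fderiv ℝ (fun y' => Γ y' v w) y = fderiv ℝ (fun y' => Γ y' w v) y :=
    fun v w => Filter.EventuallyEq.fderiv_eq (hΓ.mono fun y' h => h v w)
  have hs := hΓ.self_of_nhds
  simp only [curvatureOf]
  rw [hd w z, hd z v, hd v w, hs w z, hs z v, hs v w]
  abel

namespace IsLocalMetric

variable [CompleteSpace E'] {G : E' → E' →L[ℝ] E' →L[ℝ] ℝ} {y : E'}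

theorem metric_curvatureOf_skew (hG : IsLocalMetric G y) (v w z t : E') :
    G y (curvatureOf (christoffel G) y v w z) t
      = -G y (curvatureOf (christoffel G) y v w t) z := by
  let cov (z w : E') : E' → E' := fun y' => covAlong G id (fun _ => z) y' w
  have dcov : ∀ z w, DifferentiableAt ℝ (cov z w) y := fun z w =>
    differentiableAt_covAlong hG contDiffAt_id contDiffAt_const w
  have first : ∀ w, (fun y' => fderiv ℝ (fun x => G x z t) y' w) =ᶠ[𝓝 y]
      fun y' => G y' (cov z w y') t + G y' z (cov t w y') := fun w => by
    filter_upwards [hG.eventually] with y' hy'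
    exact fderiv_metric_apply (F := id) hy' differentiableAt_id (differentiableAt_const z)
      (differentiableAt_const t) w
  have second : ∀ v w, fderiv ℝ (fun y' => fderiv ℝ (fun x => G x z t) y' w) y v
      = G y (covAlong G id (cov z w) y v) t + G y (cov z w y) (cov t v y)
        + (G y (cov z v y) (cov t w y) + G y z (covAlong G id (cov t w) y v)) := fun v w => by
    have const : ∀ a : E', DifferentiableAt ℝ (fun _ : E' => a) y := differentiableAt_const
    rw [(first w).fderiv_eq, fderiv_fun_add ((hG.differentiableAt.clm_apply (dcov z w)).clm_apply
      (const t)) ((hG.differentiableAt.clm_apply (const z)).clm_apply (dcov t w)), add_apply]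
    exact congrArg₂ (· + ·)
      (fderiv_metric_apply (F := id) hG differentiableAt_id (dcov z w) (const t) v)
      (fderiv_metric_apply (F := id) hG differentiableAt_id (const z) (dcov t w) v)
  have ricci : ∀ z, curvatureOf (christoffel G) y v w z
      = covAlong G id (cov z w) y v - covAlong G id (cov z v) y w := fun z => by
    simpa using (ricci_identity (F := id) (V := fun _ => z) hG contDiffAt_id contDiffAt_const
      v w).symm
  have symm : fderiv ℝ (fun y' => fderiv ℝ (fun x => G x z t) y' w) y v
      = fderiv ℝ (fun y' => fderiv ℝ (fun x => G x z t) y' v) y w :=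
    fderiv_fderiv_symm ((hG.contDiffAt.clm_apply contDiffAt_const).clm_apply contDiffAt_const) v w
  rw [second, second] at symm
  rw [hG.symm y _ z, ricci, ricci]
  simp only [map_sub, sub_apply]
  linarith

theorem isAlgebraicCurvature (hG : IsLocalMetric G y) :
    IsAlgebraicCurvature fun x y' z w => G y (curvatureOf (christoffel G) y x y' z) w := by
  refine .mk_of_skew (fun v w z t => ?_) hG.metric_curvatureOf_skew fun v w z t => ?_
  · rw [curvatureOf_swap, map_neg, neg_apply]
  · have bianchi := curvatureOf_bianchi (hG.eventually.mono fun _ h => h.christoffel_symm) v w z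
    simpa using congrArg (fun V => G y V t) bianchi

end IsLocalMetric

end LeviCivita

section GaussWeingarten

variable {E : Type*} [NormedAddCommGroup E] [NormedSpace ℝ E]
  {E' : Type*} [NormedAddCommGroup E'] [NormedSpace ℝ E']

/-- The frame `(X, a) ↦ dF(X) + a n` along `F`, whose inverse is `decomp`. -/
def frameMap (F n : E → E') (y : E) : E × ℝ →L[ℝ] E' :=
  (fderiv ℝ F y).coprod (ContinuousLinearMap.toSpanSingleton ℝ (n y))

/-- Near `y₀` the map `F` is an immersed hypersurface with transversal field `n`, of the minimal
regularity for which the induced connection has a curvature. -/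
structure IsLocalHypersurface (F n : E → E') (y₀ : E) : Prop where
  contDiffAt : ContDiffAt ℝ 3 F y₀
  contDiffAt_trans : ContDiffAt ℝ 1 n y₀
  isInvertible : (frameMap F n y₀).IsInvertible

variable {G : E' → E' →L[ℝ] E' →L[ℝ] ℝ} {F n : E → E'} {y : E}

theorem frameMap_decomp (h : (frameMap F n y).IsInvertible) (V : E') :
    fderiv ℝ F y (decomp F (n y) y V).1 + (decomp F (n y) y V).2 • n y = V :=
  h.self_apply_inverse V

theorem isInvertible_frameMap [FiniteDimensional ℝ E] [FiniteDimensional ℝ E']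
    (hdim : Module.finrank ℝ E' = Module.finrank ℝ E + 1)
    (hinj : Function.Injective (fderiv ℝ F y)) (φ : E' →L[ℝ] ℝ)
    (hφ : ∀ v, φ (fderiv ℝ F y v) = 0) (hn : φ (n y) ≠ 0) : (frameMap F n y).IsInvertible := by
  have frame_injective : Function.Injective (frameMap F n y).toLinearMap := by
    refine (injective_iff_map_eq_zero _).2 fun ⟨v, a⟩ hva => ?_
    replace hva : fderiv ℝ F y v + a • n y = 0 := hva
    have ha : a = 0 := by
      have hφa := congrArg φ hva
      rw [map_add, map_smul, hφ, map_zero, zero_add, smul_eq_mul] at hφa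
      exact (mul_eq_zero.1 hφa).resolve_right hn
    rw [ha, zero_smul, add_zero] at hva
    exact Prod.ext ((injective_iff_map_eq_zero _).1 hinj v hva) ha
  have hd : Module.finrank ℝ (E × ℝ) = Module.finrank ℝ E' := by
    rw [hdim, Module.finrank_prod, Module.finrank_self]
  exact ⟨(LinearEquiv.ofInjectiveOfFinrankEq (frameMap F n y).toLinearMap frame_injective
    hd).toContinuousLinearEquiv, ContinuousLinearMap.ext fun _ => rfl⟩

theorem gauss_formula (h : (frameMap F n y).IsInvertible) (v w : E) :
    covAlong G F (fun y' => fderiv ℝ F y' w) y v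
      = fderiv ℝ F y (inducedChristoffel G F n y v w) + localSecondForm G F n y v w • n y :=
  (frameMap_decomp h _).symm

theorem weingarten_formula (h : (frameMap F n y).IsInvertible) (v : E) :
    ∃ τ : ℝ, covAlong G F n y v = -fderiv ℝ F y (localShape G F n y v) + τ • n y := by
  refine ⟨(decomp F (n y) y (covAlong G F n y v)).2, ?_⟩
  rw [localShape, map_neg, neg_neg, frameMap_decomp h]

theorem localSecondForm_symm (hG : IsLocalMetric G (F y)) (hF : ContDiffAt ℝ 2 F y) (v w : E) :
    localSecondForm G F n y v w = localSecondForm G F n y w v := by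
  rw [localSecondForm, localSecondForm, covAlong_fderiv_symm hG hF]

namespace IsLocalHypersurface

theorem contDiffAt_two (h : IsLocalHypersurface F n y) : ContDiffAt ℝ 2 F y :=
  h.contDiffAt.of_le (by norm_num)

theorem contDiffAt_fderiv (h : IsLocalHypersurface F n y) (w : E) :
    ContDiffAt ℝ 2 (fun y' => fderiv ℝ F y' w) y :=
  (h.contDiffAt.fderiv_right (m := 2) (by norm_num)).clm_apply contDiffAt_const

theorem differentiableAt (h : IsLocalHypersurface F n y) : DifferentiableAt ℝ F y :=
  h.contDiffAt.differentiableAt (by simp)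

theorem differentiableAt_trans (h : IsLocalHypersurface F n y) : DifferentiableAt ℝ n y :=
  h.contDiffAt_trans.differentiableAt (by simp)

theorem contDiffAt_frameMap (h : IsLocalHypersurface F n y) :
    ContDiffAt ℝ 1 (frameMap F n) y := by
  have hspan := (ContinuousLinearMap.toSpanSingletonCLE (𝕜 := ℝ) (E := E')
    ).contDiff.contDiffAt.comp y h.contDiffAt_trans
  exact (ContinuousLinearMap.coprodEquivL ℝ (𝕜 := ℝ) (E := E) (F := ℝ) (G := E')
    ).contDiff.contDiffAt.comp y ((h.contDiffAt_two.fderiv_right (by norm_num)).prodMk hspan)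

theorem localSecondForm_radical (h : IsLocalHypersurface F n y) (hG : IsLocalMetric G (F y))
    {ξ : E → E} (hξ : DifferentiableAt ℝ ξ y)
    (hrad : ∀ᶠ y' in 𝓝 y, ∀ z, G (F y') (fderiv ℝ F y' (ξ y')) (fderiv ℝ F y' z) = 0)
    (htrans : G (F y) (fderiv ℝ F y (ξ y)) (n y) ≠ 0) (w : E) :
    localSecondForm G F n y w (ξ y) = 0 := by
  have hdξ : DifferentiableAt ℝ (fun y' => fderiv ℝ F y' (ξ y')) y :=
    (differentiableAt_fderiv h.contDiffAt_two).clm_apply hξ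
  have null : (fun y' => G (F y') (fderiv ℝ F y' (ξ y')) (fderiv ℝ F y' (ξ y'))) =ᶠ[𝓝 y]
      fun _ => (0 : ℝ) := hrad.mono fun y' hy' => hy' (ξ y')
  have dnull : fderiv ℝ (fun y' => G (F y') (fderiv ℝ F y' (ξ y')) (fderiv ℝ F y' (ξ y'))) y w
      = 0 := by simp [null.fderiv_eq]
  have normal : G (F y) (fderiv ℝ F y (ξ y))
      (covAlong G F (fun y' => fderiv ℝ F y' (ξ y')) y w) = 0 := by
    rw [fderiv_metric_apply hG h.differentiableAt hdξ hdξ, hG.symm] at dnull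
    linarith
  rw [covAlong_fderiv_apply h.contDiffAt_two hξ, gauss_formula h.isInvertible] at normal
  simp only [map_add, map_smul, hrad.self_of_nhds, zero_add, smul_eq_mul] at normal
  exact (mul_eq_zero.1 normal).resolve_right htrans

variable [CompleteSpace E]

theorem eventually_isInvertible (h : IsLocalHypersurface F n y) :
    ∀ᶠ y' in 𝓝 y, (frameMap F n y').IsInvertible :=
  Lightlike.eventually_isInvertible h.contDiffAt_frameMap.continuousAt h.isInvertible

theorem differentiableAt_decomp (h : IsLocalHypersurface F n y) {V : E → E'}
    (hV : DifferentiableAt ℝ V y) : DifferentiableAt ℝ (fun y' => decomp F (n y') y' (V y')) y :=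
  (((h.isInvertible.contDiffAt_map_inverse (n := 1)).comp y h.contDiffAt_frameMap
    ).differentiableAt (by simp)).clm_apply hV

variable [CompleteSpace E']

theorem covAlong_covAlong_fderiv (h : IsLocalHypersurface F n y) (hG : IsLocalMetric G (F y))
    (v w z : E) :
    ∃ r : ℝ, covAlong G F (fun y' => covAlong G F (fun y'' => fderiv ℝ F y'' z) y' w) y v
      = fderiv ℝ F y (fderiv ℝ (fun y' => inducedChristoffel G F n y' w z) y v
          + inducedChristoffel G F n y v (inducedChristoffel G F n y w z)
          - localSecondForm G F n y w z • localShape G F n y v) + r • n y := by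
  have hdecomp := h.differentiableAt_decomp
    (differentiableAt_covAlong hG h.contDiffAt_two (h.contDiffAt_fderiv z) w)
  have hX : DifferentiableAt ℝ (fun y' => inducedChristoffel G F n y' w z) y := hdecomp.fst
  have hB : DifferentiableAt ℝ (fun y' => localSecondForm G F n y' w z) y := hdecomp.snd
  have gauss : (fun y' => covAlong G F (fun y'' => fderiv ℝ F y'' z) y' w) =ᶠ[𝓝 y]
      fun y' => fderiv ℝ F y' (inducedChristoffel G F n y' w z)
        + localSecondForm G F n y' w z • n y' :=
    h.eventually_isInvertible.mono fun y' hy' => gauss_formula hy' w z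
  obtain ⟨τ, weingarten⟩ := weingarten_formula (G := G) h.isInvertible v
  rw [covAlong_congr gauss,
    covAlong_add ((differentiableAt_fderiv h.contDiffAt_two).clm_apply hX)
      (hB.fun_smul h.differentiableAt_trans),
    covAlong_fderiv_apply h.contDiffAt_two hX, gauss_formula h.isInvertible,
    covAlong_smul hB h.differentiableAt_trans, weingarten]
  refine ⟨localSecondForm G F n y v (inducedChristoffel G F n y w z)
    + fderiv ℝ (fun y' => localSecondForm G F n y' w z) y v + localSecondForm G F n y w z * τ, ?_⟩
  simp only [map_add, map_sub, map_smul]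
  module

theorem gauss_equation (h : IsLocalHypersurface F n y) (hG : IsLocalMetric G (F y)) (v w z : E) :
    ∃ r : ℝ, curvatureOf (christoffel G) (F y) (fderiv ℝ F y v) (fderiv ℝ F y w) (fderiv ℝ F y z)
      = fderiv ℝ F y (curvatureOf (inducedChristoffel G F n) y v w z
          - localSecondForm G F n y w z • localShape G F n y v
          + localSecondForm G F n y v z • localShape G F n y w) + r • n y := by
  obtain ⟨r, hr⟩ := h.covAlong_covAlong_fderiv hG v w z
  obtain ⟨s, hs⟩ := h.covAlong_covAlong_fderiv hG w v z
  refine ⟨r - s, ?_⟩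
  rw [← ricci_identity hG h.contDiffAt_two (h.contDiffAt_fderiv z), hr, hs]
  simp only [curvatureOf, map_add, map_sub]
  module

theorem curvatureOf_inducedChristoffel_eq (h : IsLocalHypersurface F n y)
    (hG : IsLocalMetric G (F y)) {c : ℝ}
    (hR : ∀ v w z, curvatureOf (christoffel G) (F y) v w z
      = c • (G (F y) w z • v - G (F y) v z • w)) (v w z : E) :
    curvatureOf (inducedChristoffel G F n) y v w z
      = c • (G (F y) (fderiv ℝ F y w) (fderiv ℝ F y z) • v
          - G (F y) (fderiv ℝ F y v) (fderiv ℝ F y z) • w)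
        + localSecondForm G F n y w z • localShape G F n y v
        - localSecondForm G F n y v z • localShape G F n y w := by
  obtain ⟨r, hr⟩ := h.gauss_equation hG v w z
  rw [hR] at hr
  have tangential : c • (G (F y) (fderiv ℝ F y w) (fderiv ℝ F y z) • v
        - G (F y) (fderiv ℝ F y v) (fderiv ℝ F y z) • w)
      = curvatureOf (inducedChristoffel G F n) y v w z
        - localSecondForm G F n y w z • localShape G F n y v
        + localSecondForm G F n y v z • localShape G F n y w := by
    refine congrArg Prod.fst (h.isInvertible.injective (a₁ := (_, 0)) (a₂ := (_, r))
      (Eq.trans ?_ hr))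
    simp only [frameMap, ContinuousLinearMap.coprod_apply, map_sub, map_smul, map_zero, add_zero]
  rw [tangential]
  abel

end IsLocalHypersurface

end GaussWeingarten

section Charts

variable {E : Type*} [NormedAddCommGroup E] [NormedSpace ℝ E]
  {M : Type*} [TopologicalSpace M] [ChartedSpace E M] [IsManifold 𝓘(ℝ, E) ∞ M]

theorem mfderiv_extChartAt_symm_apply {x p : M} (hp : p ∈ (chartAt E x).source)
    (v : TangentSpace 𝓘(ℝ, E) p) :
    mfderiv 𝓘(ℝ, E) 𝓘(ℝ, E) (extChartAt 𝓘(ℝ, E) x).symm (extChartAt 𝓘(ℝ, E) x p)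
      (mfderiv 𝓘(ℝ, E) 𝓘(ℝ, E) (extChartAt 𝓘(ℝ, E) x) p v) = v := by
  have h := mfderivWithin_extChartAt_symm_comp_mfderiv_extChartAt' (I := 𝓘(ℝ, E)) (x := x) (y := p)
    (by simpa using hp)
  rw [modelWithCornersSelf_coe, Set.range_id, mfderivWithin_univ] at h
  exact congrArg (fun L => L v) h

theorem mfderiv_extChartAt_apply_symm {x p : M} (hp : p ∈ (chartAt E x).source) (v : E) :
    mfderiv 𝓘(ℝ, E) 𝓘(ℝ, E) (extChartAt 𝓘(ℝ, E) x) p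
      (mfderiv 𝓘(ℝ, E) 𝓘(ℝ, E) (extChartAt 𝓘(ℝ, E) x).symm (extChartAt 𝓘(ℝ, E) x p) v) = v := by
  have h := mfderiv_extChartAt_comp_mfderivWithin_extChartAt_symm' (I := 𝓘(ℝ, E)) (x := x) (y := p)
    (by simpa using hp)
  rw [modelWithCornersSelf_coe, Set.range_id, mfderivWithin_univ] at h
  exact congrArg (fun L => L v) h

theorem mfderiv_extChartAt_self_apply (x : M) (v : TangentSpace 𝓘(ℝ, E) x) :
    mfderiv 𝓘(ℝ, E) 𝓘(ℝ, E) (extChartAt 𝓘(ℝ, E) x) x v = v := by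
  rw [mfderiv_extChartAt_self]
  rfl

theorem contMDiffAt_extChartAt_symm (x : M) :
    ContMDiffAt 𝓘(ℝ, E) 𝓘(ℝ, E) ∞ (extChartAt 𝓘(ℝ, E) x).symm (extChartAt 𝓘(ℝ, E) x x) :=
  (contMDiffOn_extChartAt_symm x).contMDiffAt (extChartAt_target_mem_nhds x)

theorem mdifferentiableAt_extChartAt_symm {x p : M} (hp : p ∈ (chartAt E x).source) :
    MDifferentiableAt 𝓘(ℝ, E) 𝓘(ℝ, E) (extChartAt 𝓘(ℝ, E) x).symm (extChartAt 𝓘(ℝ, E) x p) := by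
  have h := mdifferentiableWithinAt_extChartAt_symm (I := 𝓘(ℝ, E)) (x := x)
    ((extChartAt 𝓘(ℝ, E) x).map_source (by simpa using hp))
  rwa [modelWithCornersSelf_coe, Set.range_id, mdifferentiableWithinAt_univ] at h

theorem metricInChart_mfderiv (g : SemiRiemannianMetric E M) {x p : M}
    (hp : p ∈ (chartAt E x).source) (v w : TangentSpace 𝓘(ℝ, E) p) :
    metricInChart g x (extChartAt 𝓘(ℝ, E) x p)
      (mfderiv 𝓘(ℝ, E) 𝓘(ℝ, E) (extChartAt 𝓘(ℝ, E) x) p v)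
      (mfderiv 𝓘(ℝ, E) 𝓘(ℝ, E) (extChartAt 𝓘(ℝ, E) x) p w) = g.val p v w := by
  -- Transports `g.val` along an equality of base points, which `rw` cannot do.
  have val_congr : ∀ p' : M, p' = p → ∀ v w : E,
      (g.val p' : E →L[ℝ] E →L[ℝ] ℝ) v w = (g.val p : E →L[ℝ] E →L[ℝ] ℝ) v w := by
    rintro p' rfl v w; rfl
  refine Eq.trans ?_ (val_congr _ ((extChartAt 𝓘(ℝ, E) x).left_inv (by simpa using hp)) v w)
  conv_rhs => rw [← mfderiv_extChartAt_symm_apply hp v, ← mfderiv_extChartAt_symm_apply hp w]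
  rfl

theorem metricInChart_self (g : SemiRiemannianMetric E M) (x : M)
    (v w : TangentSpace 𝓘(ℝ, E) x) :
    metricInChart g x (extChartAt 𝓘(ℝ, E) x x) v w = g.val x v w := by
  have h := metricInChart_mfderiv g (mem_chart_source E x) v w
  rwa [mfderiv_extChartAt_self_apply, mfderiv_extChartAt_self_apply] at h

theorem metricInChart_symm (g : SemiRiemannianMetric E M) (x : M) (y v w : E) :
    metricInChart g x y v w = metricInChart g x y w v :=
  g.symm _ (mfderiv 𝓘(ℝ, E) 𝓘(ℝ, E) (extChartAt 𝓘(ℝ, E) x).symm y v)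
    (mfderiv 𝓘(ℝ, E) 𝓘(ℝ, E) (extChartAt 𝓘(ℝ, E) x).symm y w)

theorem symmL_trivializationAt_apply {x : M} {y : E} (hy : y ∈ (extChartAt 𝓘(ℝ, E) x).target)
    (v : E) :
    (trivializationAt E (TangentSpace 𝓘(ℝ, E) : M → Type _) x).symmL ℝ
      ((extChartAt 𝓘(ℝ, E) x).symm y) v
      = mfderiv 𝓘(ℝ, E) 𝓘(ℝ, E) (extChartAt 𝓘(ℝ, E) x).symm y v := by
  have h := TangentBundle.symmL_trivializationAt (I := 𝓘(ℝ, E)) (x₀ := x)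
    (x := (extChartAt 𝓘(ℝ, E) x).symm y) (by simpa using (extChartAt 𝓘(ℝ, E) x).map_target hy)
  rw [modelWithCornersSelf_coe, Set.range_id, mfderivWithin_univ,
    (extChartAt 𝓘(ℝ, E) x).right_inv hy] at h
  exact congrArg (fun L : E →L[ℝ] E => L v) h

theorem contMDiffOn_symmL_trivializationAt (x : M) (v : E) :
    ContMDiffOn 𝓘(ℝ, E) (𝓘(ℝ, E).prod 𝓘(ℝ, E)) ∞
      (fun p => Bundle.TotalSpace.mk' E p
        ((trivializationAt E (TangentSpace 𝓘(ℝ, E) : M → Type _) x).symmL ℝ p v))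
      (chartAt E x).source := by
  let e := trivializationAt E (TangentSpace 𝓘(ℝ, E) : M → Type _) x
  refine e.contMDiffOn_section_baseSet_iff.2 ((contMDiffOn_const (c := v)).congr fun p hp => ?_)
  rw [e.symmL_apply hp, e.apply_mk_symm hp]

theorem contMDiffOn_metric_symmL (g : SemiRiemannianMetric E M) (x : M) (v w : E) :
    ContMDiffOn 𝓘(ℝ, E) 𝓘(ℝ, ℝ) ∞
      (fun p => g.val p
        ((trivializationAt E (TangentSpace 𝓘(ℝ, E) : M → Type _) x).symmL ℝ p v)
        ((trivializationAt E (TangentSpace 𝓘(ℝ, E) : M → Type _) x).symmL ℝ p w))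
      (chartAt E x).source := fun p hp =>
  (Bundle.contMDiffWithinAt_totalSpace.1 <|
    ContMDiffWithinAt.clm_bundle_apply₂ (F₁ := E) (F₂ := E) (F₃ := ℝ) (E₃ := Bundle.Trivial M ℝ)
      g.contMDiff.contMDiffAt.contMDiffWithinAt
      (contMDiffOn_symmL_trivializationAt x v p hp)
      (contMDiffOn_symmL_trivializationAt x w p hp)).2

theorem contDiffOn_metricInChart_apply (g : SemiRiemannianMetric E M) (x : M) (v w : E) :
    ContDiffOn ℝ ∞ (fun y => metricInChart g x y v w) (extChartAt 𝓘(ℝ, E) x).target := by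
  rw [← contMDiffOn_iff_contDiffOn]
  refine ((contMDiffOn_metric_symmL g x v w).comp (contMDiffOn_extChartAt_symm x)
    fun y hy => by simpa using (extChartAt 𝓘(ℝ, E) x).map_target hy).congr fun y hy => ?_
  rw [Function.comp_apply, symmL_trivializationAt_apply hy, symmL_trivializationAt_apply hy]
  rfl

variable [FiniteDimensional ℝ E]

theorem contDiffAt_metricInChart (g : SemiRiemannianMetric E M) (x : M) :
    ContDiffAt ℝ ∞ (metricInChart g x) (extChartAt 𝓘(ℝ, E) x x) :=
  (contDiffOn_clm_apply.2 fun v => contDiffOn_clm_apply.2 fun w =>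
    contDiffOn_metricInChart_apply g x v w).contDiffAt (extChartAt_target_mem_nhds x)

theorem isInvertible_of_nondegenerate (A : E →L[ℝ] E →L[ℝ] ℝ)
    (hA : ∀ v, (∀ w, A v w = 0) → v = 0) : A.IsInvertible := by
  have hinj : Function.Injective A.toLinearMap := (injective_iff_map_eq_zero _).2 fun v hv =>
    hA v fun w => congrArg (fun L : E →L[ℝ] ℝ => L w) hv
  have hdim : Module.finrank ℝ E = Module.finrank ℝ (E →L[ℝ] ℝ) := by
    rw [← (LinearMap.toContinuousLinearMap : (E →ₗ[ℝ] ℝ) ≃ₗ[ℝ] _).finrank_eq]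
    exact Subspace.dual_finrank_eq.symm
  exact ⟨(LinearEquiv.ofInjectiveOfFinrankEq A.toLinearMap hinj hdim).toContinuousLinearEquiv,
    ContinuousLinearMap.ext fun _ => rfl⟩

theorem isLocalMetric_metricInChart (g : SemiRiemannianMetric E M) (x : M) :
    IsLocalMetric (metricInChart g x) (extChartAt 𝓘(ℝ, E) x x) where
  contDiffAt := (contDiffAt_metricInChart g x).of_le (by norm_cast)
  symm := metricInChart_symm g x
  isInvertible := isInvertible_of_nondegenerate _ fun v hv => g.nondegenerate x v fun w => by
    rw [← metricInChart_self g x v w]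
    exact hv w

end Charts

section Immersion

variable {E : Type*} [NormedAddCommGroup E] [NormedSpace ℝ E]
  {M : Type*} [TopologicalSpace M] [ChartedSpace E M]
  {E' : Type*} [NormedAddCommGroup E']
  {N : Type*} [TopologicalSpace N] [ChartedSpace E' N]
  {f : M → N}

theorem eventually_mem_chart_source (hf : Continuous f) (u : M) :
    ∀ᶠ y in 𝓝 (extChartAt 𝓘(ℝ, E) u u), ∃ p : M, p ∈ (chartAt E u).source ∧
      f p ∈ (chartAt E' (f u)).source ∧ extChartAt 𝓘(ℝ, E) u p = y := by
  have hsymm := (hf.continuousAt.comp (continuousAt_extChartAt_symm (I := 𝓘(ℝ, E)) u))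
  filter_upwards [extChartAt_target_mem_nhds (I := 𝓘(ℝ, E)) u,
    hsymm.preimage_mem_nhds ((chartAt E' (f u)).open_source.mem_nhds (by simp))] with y hy hy'
  exact ⟨(extChartAt 𝓘(ℝ, E) u).symm y,
    by simpa using (extChartAt 𝓘(ℝ, E) u).map_target hy, hy',
    (extChartAt 𝓘(ℝ, E) u).right_inv hy⟩

variable [NormedSpace ℝ E']

theorem mapInChart_extChartAt (f : M → N) {u p : M} (hp : p ∈ (chartAt E u).source) :
    mapInChart (E := E) (E' := E') f u (extChartAt 𝓘(ℝ, E) u p)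
      = extChartAt 𝓘(ℝ, E') (f u) (f p) := by
  simp only [mapInChart, writtenInExtChartAt, Function.comp_apply]
  rw [(extChartAt 𝓘(ℝ, E) u).left_inv (by simpa using hp)]

theorem contDiffAt_mapInChart (hf : ContMDiff 𝓘(ℝ, E) 𝓘(ℝ, E') ∞ f) (u : M) :
    ContDiffAt ℝ ∞ (mapInChart (E := E) (E' := E') f u) (extChartAt 𝓘(ℝ, E) u u) := by
  have h := (contMDiffAt_iff.1 (hf u)).2
  rwa [modelWithCornersSelf_coe, Set.range_id, contDiffWithinAt_univ] at h

theorem alongInChart_extChartAt (ν : ∀ p : M, TangentSpace 𝓘(ℝ, E') (f p)) {u p : M}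
    (hp : p ∈ (chartAt E u).source) :
    alongInChart (E := E) f ν u (extChartAt 𝓘(ℝ, E) u p)
      = mfderiv 𝓘(ℝ, E') 𝓘(ℝ, E') (extChartAt 𝓘(ℝ, E') (f u)) (f p) (ν p) := by
  rw [alongInChart, (extChartAt 𝓘(ℝ, E) u).left_inv (by simpa using hp)]

variable [IsManifold 𝓘(ℝ, E') ∞ N]

theorem alongInChart_self (ν : ∀ p : M, TangentSpace 𝓘(ℝ, E') (f p)) (u : M) :
    alongInChart (E := E) f ν u (extChartAt 𝓘(ℝ, E) u u) = ν u := by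
  rw [alongInChart_extChartAt ν (mem_chart_source E u), mfderiv_extChartAt_self_apply]

theorem isLocalMetric_mapInChart [FiniteDimensional ℝ E']
    (g : SemiRiemannianMetric E' N) (f : M → N) (u : M) :
    IsLocalMetric (metricInChart g (f u))
      (mapInChart (E := E) f u (extChartAt 𝓘(ℝ, E) u u)) := by
  rw [mapInChart_extChartAt f (mem_chart_source E u)]
  exact isLocalMetric_metricInChart g (f u)

variable [IsManifold 𝓘(ℝ, E) ∞ M]

theorem contDiffAt_alongInChart {u : M} {ν : ∀ p : M, TangentSpace 𝓘(ℝ, E') (f p)}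
    (hν : ContMDiffAt 𝓘(ℝ, E) 𝓘(ℝ, E').tangent ∞
      (fun p => (⟨f p, ν p⟩ : TangentBundle 𝓘(ℝ, E') N)) u) :
    ContDiffAt ℝ ∞ (alongInChart f ν u) (extChartAt 𝓘(ℝ, E) u u) := by
  obtain ⟨hf, hcoord⟩ := Bundle.contMDiffAt_totalSpace.1 hν
  have hmfderiv : ContMDiffAt 𝓘(ℝ, E) 𝓘(ℝ, E') ∞ (fun p : M =>
      (mfderiv 𝓘(ℝ, E') 𝓘(ℝ, E') (extChartAt 𝓘(ℝ, E') (f u)) (f p) (ν p) : E')) u := by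
    refine hcoord.congr_of_eventuallyEq ?_
    filter_upwards [hf.continuousAt.preimage_mem_nhds
      ((chartAt E' (f u)).open_source.mem_nhds (mem_chart_source E' (f u)))] with p hp
    rw [← TangentBundle.continuousLinearMapAt_trivializationAt hp]
    exact (trivializationAt E' (TangentSpace 𝓘(ℝ, E')) (f u)).continuousLinearMapAt_apply_of_mem
      (R := ℝ) hp (ν p)
  exact (hmfderiv.comp_of_eq (contMDiffAt_extChartAt_symm u) (extChartAt_to_inv u)).contDiffAt

theorem mdifferentiableAt_mapInChart (hf : ContMDiff 𝓘(ℝ, E) 𝓘(ℝ, E') ∞ f) {u p : M}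
    (hp : p ∈ (chartAt E u).source) (hfp : f p ∈ (chartAt E' (f u)).source) :
    MDifferentiableAt 𝓘(ℝ, E) 𝓘(ℝ, E') (mapInChart (E := E) (E' := E') f u)
      (extChartAt 𝓘(ℝ, E) u p) := by
  have hinv : (extChartAt 𝓘(ℝ, E) u).symm (extChartAt 𝓘(ℝ, E) u p) = p :=
    (extChartAt 𝓘(ℝ, E) u).left_inv (by simpa using hp)
  have hf' : MDifferentiableAt 𝓘(ℝ, E) 𝓘(ℝ, E') (f ∘ (extChartAt 𝓘(ℝ, E) u).symm)
      (extChartAt 𝓘(ℝ, E) u p) :=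
    ((hf _).mdifferentiableAt (by simp)).comp _ (mdifferentiableAt_extChartAt_symm hp)
  have hchart : MDifferentiableAt 𝓘(ℝ, E') 𝓘(ℝ, E') (extChartAt 𝓘(ℝ, E') (f u))
      ((f ∘ (extChartAt 𝓘(ℝ, E) u).symm) (extChartAt 𝓘(ℝ, E) u p)) := by
    rw [Function.comp_apply, hinv]
    exact mdifferentiableAt_extChartAt hfp
  exact hchart.comp _ hf'

theorem fderiv_mapInChart (hf : ContMDiff 𝓘(ℝ, E) 𝓘(ℝ, E') ∞ f) {u p : M}
    (hp : p ∈ (chartAt E u).source) (hfp : f p ∈ (chartAt E' (f u)).source)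
    (v : TangentSpace 𝓘(ℝ, E) p) :
    fderiv ℝ (mapInChart (E := E) (E' := E') f u) (extChartAt 𝓘(ℝ, E) u p)
      (mfderiv 𝓘(ℝ, E) 𝓘(ℝ, E) (extChartAt 𝓘(ℝ, E) u) p v)
      = mfderiv 𝓘(ℝ, E') 𝓘(ℝ, E') (extChartAt 𝓘(ℝ, E') (f u)) (f p)
        (mfderiv 𝓘(ℝ, E) 𝓘(ℝ, E') f p v) := by
  have hev : mapInChart (E := E) (E' := E') f u ∘ extChartAt 𝓘(ℝ, E) u
      =ᶠ[𝓝 p] extChartAt 𝓘(ℝ, E') (f u) ∘ f := by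
    filter_upwards [(chartAt E u).open_source.mem_nhds hp] with q hq
    exact mapInChart_extChartAt f hq
  have h := hev.mfderiv_eq (I := 𝓘(ℝ, E)) (I' := 𝓘(ℝ, E'))
  rw [mfderiv_comp p (mdifferentiableAt_mapInChart hf hp hfp) (mdifferentiableAt_extChartAt hp),
    mfderiv_comp p (mdifferentiableAt_extChartAt hfp) ((hf p).mdifferentiableAt (by simp)),
    mfderiv_eq_fderiv] at h
  exact congrArg (fun L => L v) h

theorem metricInChart_fderiv_mapInChart (g : SemiRiemannianMetric E' N)
    (hf : ContMDiff 𝓘(ℝ, E) 𝓘(ℝ, E') ∞ f) {u p : M}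
    (hp : p ∈ (chartAt E u).source) (hfp : f p ∈ (chartAt E' (f u)).source)
    (v w : TangentSpace 𝓘(ℝ, E) p) :
    metricInChart g (f u) (mapInChart (E := E) (E' := E') f u (extChartAt 𝓘(ℝ, E) u p))
      (fderiv ℝ (mapInChart (E := E) (E' := E') f u) (extChartAt 𝓘(ℝ, E) u p)
        (mfderiv 𝓘(ℝ, E) 𝓘(ℝ, E) (extChartAt 𝓘(ℝ, E) u) p v))
      (fderiv ℝ (mapInChart (E := E) (E' := E') f u) (extChartAt 𝓘(ℝ, E) u p)
        (mfderiv 𝓘(ℝ, E) 𝓘(ℝ, E) (extChartAt 𝓘(ℝ, E) u) p w))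
      = inducedMetric g f p v w := by
  rw [fderiv_mapInChart hf hp hfp v, fderiv_mapInChart hf hp hfp w, mapInChart_extChartAt f hp,
    metricInChart_mfderiv g hfp]
  rfl

end Immersion

section SpaceForm

variable {E : Type*} [NormedAddCommGroup E] [NormedSpace ℝ E]

theorem IsLocalMetric.curvatureOf_eq_of_sectional_eq [CompleteSpace E]
    {G : E → E →L[ℝ] E →L[ℝ] ℝ} {y : E} (hG : IsLocalMetric G y) {v₀ w₀ : E}
    (h₀ : gramDet (fun v w => G y v w) v₀ w₀ ≠ 0) {c : ℝ}
    (hc : ∀ v w, gramDet (fun v w => G y v w) v w ≠ 0 →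
      G y (curvatureOf (christoffel G) y v w w) v / gramDet (fun v w => G y v w) v w = c)
    (v w z : E) :
    curvatureOf (christoffel G) y v w z = c • (G y w z • v - G y v z • w) := by
  let b : LinearMap.BilinForm ℝ E := LinearMap.mk₂ ℝ (fun v w : E => G y v w)
    (fun _ _ _ => by simp) (fun _ _ _ => by simp) (fun _ _ _ => by simp) (fun _ _ _ => by simp)
  have linear (w z t : E) :
      IsLinearMap ℝ fun v => G y (curvatureOf (christoffel G) y v w z) t := by
    constructor <;> intros <;>
      simp only [hG.curvatureOf_eq, christoffel_eq, map_add, map_sub, map_smul, add_apply,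
        sub_apply, smul_apply, smul_eq_mul] <;> ring
  refine hG.isInvertible.injective (ContinuousLinearMap.ext fun t => ?_)
  refine (hG.isAlgebraicCurvature.eq_spaceFormTensor_of_sectional_eq linear (g := b) (hG.symm y)
    h₀ hc v w z t).trans ?_
  simp only [map_sub, map_smul, sub_apply, smul_apply, smul_eq_mul]
  rfl

theorem HasConstantSectionalCurvature.riemann_eq [FiniteDimensional ℝ E]
    {N : Type*} [TopologicalSpace N] [ChartedSpace E N] [IsManifold 𝓘(ℝ, E) ∞ N]
    {g : SemiRiemannianMetric E N} {c : ℝ} (hc : HasConstantSectionalCurvature g c) {x : N}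
    {v₀ w₀ : TangentSpace 𝓘(ℝ, E) x} (h₀ : gramDet (fun v w => g.val x v w) v₀ w₀ ≠ 0)
    (v w z : TangentSpace 𝓘(ℝ, E) x) :
    riemann g x v w z = c • (g.val x w z • v - g.val x v z • w) := by
  have : CompleteSpace E := FiniteDimensional.complete ℝ E
  have val_eq : metricInChart g x (extChartAt 𝓘(ℝ, E) x x) = (g.val x : E →L[ℝ] E →L[ℝ] ℝ) :=
    ContinuousLinearMap.ext fun v => ContinuousLinearMap.ext fun w => metricInChart_self g x v w
  have h := (isLocalMetric_metricInChart g x).curvatureOf_eq_of_sectional_eq (v₀ := v₀) (w₀ := w₀)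
    (c := c) (by rw [val_eq]; exact h₀) (by rw [val_eq]; exact hc x) v w z
  rwa [val_eq] at h

end SpaceForm

section Hypersurface

variable {E : Type*} [NormedAddCommGroup E] [NormedSpace ℝ E]
  {M : Type*} [TopologicalSpace M] [ChartedSpace E M]
  {E' : Type*} [NormedAddCommGroup E'] [NormedSpace ℝ E']
  {N : Type*} [TopologicalSpace N] [ChartedSpace E' N] [IsManifold 𝓘(ℝ, E') ∞ N]
  {f : M → N} {g : SemiRiemannianMetric E' N}

theorem inducedMetric_symm (u : M) (x y : TangentSpace 𝓘(ℝ, E) u) :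
    inducedMetric g f u x y = inducedMetric g f u y x :=
  g.symm (f u) (mfderiv 𝓘(ℝ, E) 𝓘(ℝ, E') f u x) (mfderiv 𝓘(ℝ, E) 𝓘(ℝ, E') f u y)

theorem metricInChart_mapInChart_self (u : M) :
    metricInChart g (f u) (mapInChart (E := E) (E' := E') f u (extChartAt 𝓘(ℝ, E) u u))
      = (g.val (f u) : E' →L[ℝ] E' →L[ℝ] ℝ) := by
  rw [mapInChart_extChartAt f (mem_chart_source E u)]
  exact ContinuousLinearMap.ext fun V => ContinuousLinearMap.ext fun W =>
    metricInChart_self g (f u) V W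

theorem secondForm_symm [FiniteDimensional ℝ E'] (hf : ContMDiff 𝓘(ℝ, E) 𝓘(ℝ, E') ∞ f)
    (ν : ∀ p : M, TangentSpace 𝓘(ℝ, E') (f p)) (u : M) (x y : TangentSpace 𝓘(ℝ, E) u) :
    secondForm g f ν u x y = secondForm g f ν u y x :=
  localSecondForm_symm (isLocalMetric_mapInChart g f u)
    ((contDiffAt_mapInChart hf u).of_le (by norm_cast)) x y

variable [IsManifold 𝓘(ℝ, E) ∞ M]

theorem fderiv_mapInChart_self (hf : ContMDiff 𝓘(ℝ, E) 𝓘(ℝ, E') ∞ f) (u : M)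
    (v : TangentSpace 𝓘(ℝ, E) u) :
    fderiv ℝ (mapInChart (E := E) (E' := E') f u) (extChartAt 𝓘(ℝ, E) u u) v
      = mfderiv 𝓘(ℝ, E) 𝓘(ℝ, E') f u v := by
  have h := fderiv_mapInChart hf (mem_chart_source E u) (mem_chart_source E' (f u)) v
  rwa [mfderiv_extChartAt_self_apply, mfderiv_extChartAt_self_apply] at h

variable {S : Screen (E := E) g f} {U : Set M} {ξ : ∀ p : M, TangentSpace 𝓘(ℝ, E) p}
  {ν : ∀ p : M, TangentSpace 𝓘(ℝ, E') (f p)} {u : M}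

namespace IsNormalizingPair

theorem gramDet_ne_zero (h : IsNormalizingPair S U ξ ν) (hu : u ∈ U) :
    gramDet (fun V W => g.val (f u) V W) (mfderiv 𝓘(ℝ, E) 𝓘(ℝ, E') f u (ξ u)) (ν u) ≠ 0 := by
  have hξ : g.val (f u) (mfderiv 𝓘(ℝ, E) 𝓘(ℝ, E') f u (ξ u))
      (mfderiv 𝓘(ℝ, E) 𝓘(ℝ, E') f u (ξ u)) = 0 := h.mem_radical u hu (ξ u)
  simp [gramDet, hξ, h.pairing u hu]

theorem eventually_metricInChart_eq_zero (hf : ContMDiff 𝓘(ℝ, E) 𝓘(ℝ, E') ∞ f)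
    (h : IsNormalizingPair S U ξ ν) (hu : u ∈ U) :
    ∀ᶠ y in 𝓝 (extChartAt 𝓘(ℝ, E) u u), ∀ z,
      metricInChart g (f u) (mapInChart (E := E) (E' := E') f u y)
        (fderiv ℝ (mapInChart (E := E) (E' := E') f u) y (alongInChart (id : M → M) ξ u y))
        (fderiv ℝ (mapInChart (E := E) (E' := E') f u) y z) = 0 := by
  have preimage_mem : (extChartAt 𝓘(ℝ, E) u).symm ⁻¹' U ∈ 𝓝 (extChartAt 𝓘(ℝ, E) u u) :=
    extChartAt_preimage_mem_nhds (h.isOpen.mem_nhds hu)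
  filter_upwards [eventually_mem_chart_source (E' := E') hf.continuous u, preimage_mem]
  rintro _ ⟨p, hp, hfp, rfl⟩ hpU z
  rw [Set.mem_preimage, (extChartAt 𝓘(ℝ, E) u).left_inv (by simpa using hp)] at hpU
  have key := metricInChart_fderiv_mapInChart g hf hp hfp (ξ p)
    (mfderiv 𝓘(ℝ, E) 𝓘(ℝ, E) (extChartAt 𝓘(ℝ, E) u).symm (extChartAt 𝓘(ℝ, E) u p) z)
  rw [mfderiv_extChartAt_apply_symm hp z] at key
  rw [alongInChart_extChartAt (f := (id : M → M)) ξ hp]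
  exact key.trans (h.mem_radical p hpU _)

variable [FiniteDimensional ℝ E] [FiniteDimensional ℝ E']

theorem isLocalHypersurface (hf : IsLightlikeHypersurface (E := E) g f)
    (h : IsNormalizingPair S U ξ ν) (hu : u ∈ U) :
    IsLocalHypersurface (mapInChart (E := E) (E' := E') f u) (alongInChart (E := E) f ν u)
      (extChartAt 𝓘(ℝ, E) u u) where
  contDiffAt := (contDiffAt_mapInChart hf.contMDiff u).of_le (by norm_cast)
  contDiffAt_trans := (contDiffAt_alongInChart
    (h.smooth_trans.contMDiffAt (h.isOpen.mem_nhds hu))).of_le (by norm_cast)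
  isInvertible := by
    refine isInvertible_frameMap hf.codim_one (fun v w hvw => ?_)
      (g.val (f u) (mfderiv 𝓘(ℝ, E) 𝓘(ℝ, E') f u (ξ u))) (fun v => ?_) ?_
    · exact hf.injective_mfderiv u <| (fderiv_mapInChart_self hf.contMDiff u v).symm.trans <|
        hvw.trans (fderiv_mapInChart_self hf.contMDiff u w)
    · exact (congrArg (g.val (f u) _) (fderiv_mapInChart_self hf.contMDiff u v)).trans
        (h.mem_radical u hu v)
    · rw [alongInChart_self]
      exact ne_of_eq_of_ne (h.pairing u hu) one_ne_zero

theorem inducedCurvature_eq (hf : IsLightlikeHypersurface (E := E) g f) {c : ℝ}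
    (hc : HasConstantSectionalCurvature g c) (h : IsNormalizingPair S U ξ ν) (hu : u ∈ U)
    (x y z : TangentSpace 𝓘(ℝ, E) u) :
    inducedCurvature g f ν u x y z
      = c • (inducedMetric g f u y z • x - inducedMetric g f u x z • y)
        + secondForm g f ν u y z • shape g f ν u x
        - secondForm g f ν u x z • shape g f ν u y := by
  have : CompleteSpace E := FiniteDimensional.complete ℝ E
  have : CompleteSpace E' := FiniteDimensional.complete ℝ E'
  have ambient (V W Z : E') : curvatureOf (christoffel (metricInChart g (f u)))
      (mapInChart (E := E) f u (extChartAt 𝓘(ℝ, E) u u)) V W Z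
      = c • (metricInChart g (f u) (mapInChart (E := E) f u (extChartAt 𝓘(ℝ, E) u u)) W Z • V
        - metricInChart g (f u) (mapInChart (E := E) f u (extChartAt 𝓘(ℝ, E) u u)) V Z • W) := by
    rw [metricInChart_mapInChart_self, mapInChart_extChartAt f (mem_chart_source E u)]
    exact HasConstantSectionalCurvature.riemann_eq hc (h.gramDet_ne_zero hu) V W Z
  have gauss := (h.isLocalHypersurface hf hu).curvatureOf_inducedChristoffel_eq
    (isLocalMetric_mapInChart g f u) ambient x y z
  rw [metricInChart_mapInChart_self, fderiv_mapInChart_self hf.contMDiff,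
    fderiv_mapInChart_self hf.contMDiff, fderiv_mapInChart_self hf.contMDiff] at gauss
  exact gauss

theorem secondForm_radical (hf : IsLightlikeHypersurface (E := E) g f)
    (h : IsNormalizingPair S U ξ ν) (hu : u ∈ U) (x : TangentSpace 𝓘(ℝ, E) u) :
    secondForm g f ν u x (ξ u) = 0 := by
  have smooth : ContDiffAt ℝ ∞ (alongInChart (E := E) (id : M → M) ξ u)
      (extChartAt 𝓘(ℝ, E) u u) :=
    contDiffAt_alongInChart (f := (id : M → M)) (h.smooth_rad.contMDiffAt (h.isOpen.mem_nhds hu))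
  have value : alongInChart (E := E) (id : M → M) ξ u (extChartAt 𝓘(ℝ, E) u u) = ξ u :=
    alongInChart_self (f := (id : M → M)) ξ u
  have key := (h.isLocalHypersurface hf hu).localSecondForm_radical
    (isLocalMetric_mapInChart g f u) (smooth.differentiableAt (by simp))
    (h.eventually_metricInChart_eq_zero hf.contMDiff hu) ?_ x
  · rwa [value] at key
  · rw [value, metricInChart_mapInChart_self, fderiv_mapInChart_self hf.contMDiff,
      alongInChart_self]
    exact ne_of_eq_of_ne (h.pairing u hu) one_ne_zero

-- Pair symmetry `R(ξ, x, y, w) = R(y, w, ξ, x)`: with `ξ` radical and `B(·, ξ) = 0`, the right side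
-- vanishes and the left side reduces to the term below.
theorem secondForm_mul_inducedMetric_shape (hf : IsLightlikeHypersurface (E := E) g f) {c : ℝ}
    (hc : HasConstantSectionalCurvature g c) (hS : S.IsAdmissible)
    (h : IsNormalizingPair S U ξ ν) (hu : u ∈ U) (x y w : TangentSpace 𝓘(ℝ, E) u) :
    secondForm g f ν u x y * inducedMetric g f u (shape g f ν u (ξ u)) w = 0 := by
  have secondForm_right : ∀ z, secondForm g f ν u z (ξ u) = 0 := h.secondForm_radical hf hu
  have secondForm_left (z) : secondForm g f ν u (ξ u) z = 0 := by
    rw [secondForm_symm hf.contMDiff, secondForm_right]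
  have metric_left : ∀ z, inducedMetric g f u (ξ u) z = 0 := h.mem_radical u hu
  have metric_right (z) : inducedMetric g f u z (ξ u) = 0 := by
    rw [inducedMetric_symm, metric_left]
  have pair_symm := (hS U ξ ν h u hu).2.1 (ξ u) x y w
  simpa only [inducedCurvature₄, h.inducedCurvature_eq hf hc hu, map_add, map_sub, map_smul,
    add_apply, sub_apply, smul_apply, metric_left, metric_right, secondForm_left, secondForm_right,
    smul_eq_mul, mul_zero, zero_mul, sub_zero, add_zero, zero_add] using pair_symm

end IsNormalizingPair

variable [FiniteDimensional ℝ E] [FiniteDimensional ℝ E']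

theorem Screen.IsTotallyGeodesic.isSemiSymmetric (hf : IsLightlikeHypersurface (E := E) g f)
    {c : ℝ} (hc : HasConstantSectionalCurvature g c) (hB : S.IsTotallyGeodesic) :
    S.IsSemiSymmetric := by
  intro U ξ ν h u hu v₁ v₂ x y z t
  have curvature (x y z : TangentSpace 𝓘(ℝ, E) u) : inducedCurvature g f ν u x y z
      = c • (inducedMetric g f u y z • x - inducedMetric g f u x z • y) := by
    rw [h.inducedCurvature_eq hf hc hu, hB U ξ ν h u hu, hB U ξ ν h u hu, zero_smul, zero_smul,
      add_zero, sub_zero]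
  have curvature₄ (x y z w : TangentSpace 𝓘(ℝ, E) u) : inducedCurvature₄ g f ν u x y z w
      = c * spaceFormTensor (fun a b => inducedMetric g f u a b) x y z w := by
    simp only [inducedCurvature₄, curvature, spaceFormTensor, map_sub, map_smul, sub_apply,
      smul_apply, smul_eq_mul]
  have skew (x y : TangentSpace 𝓘(ℝ, E) u) :
      inducedMetric g f u (inducedCurvature g f ν u v₁ v₂ x) y
      = -inducedMetric g f u x (inducedCurvature g f ν u v₁ v₂ y) := by
    simp only [curvature, map_sub, map_smul, sub_apply, smul_apply, smul_eq_mul,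
      inducedMetric_symm u x]
    ring
  simp only [curvature₄]
  linear_combination -c * spaceFormTensor_derivation_eq_zero
    (g := fun a b => inducedMetric g f u a b) skew x y z t

end Hypersurface

end Lightlike

end

theorem theorem5p3_general
    {E' : Type*} [NormedAddCommGroup E'] [NormedSpace ℝ E'] [FiniteDimensional ℝ E']
    {N : Type*} [TopologicalSpace N] [ChartedSpace E' N] [IsManifold 𝓘(ℝ, E') ∞ N]
    {E : Type*} [NormedAddCommGroup E] [NormedSpace ℝ E] [FiniteDimensional ℝ E]
    {M : Type*} [TopologicalSpace M] [ChartedSpace E M] [IsManifold 𝓘(ℝ, E) ∞ M]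
    {g : SemiRiemannianMetric E' N} {c : ℝ} (hc : HasConstantSectionalCurvature g c)
    {f : M → N} (hf : IsLightlikeHypersurface (E := E) g f)
    {S : Screen (E := E) g f} (hS : S.IsAdmissible)
    (hA : ∀ U ξ ν, IsNormalizingPair S U ξ ν → ∀ u ∈ U, shape g f ν u (ξ u) ∉ radical g f u) :
    S.IsTotallyGeodesic ∧ S.IsSemiSymmetric := by
  have hB : S.IsTotallyGeodesic := fun U ξ ν h u hu x y => by
    obtain ⟨w, hw⟩ := not_forall.1 (hA U ξ ν h u hu)
    exact (mul_eq_zero.1 (h.secondForm_mul_inducedMetric_shape hf hc hS hu x y w)).resolve_right hw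
  exact ⟨hB, hB.isSemiSymmetric hf hc⟩

theorem theorem5p3
    {E' : Type*} [NormedAddCommGroup E'] [NormedSpace ℝ E'] [FiniteDimensional ℝ E']
    {N : Type*} [TopologicalSpace N] [ChartedSpace E' N] [IsManifold 𝓘(ℝ, E') ∞ N]
    {E : Type*} [NormedAddCommGroup E] [NormedSpace ℝ E] [FiniteDimensional ℝ E]
    {M : Type*} [TopologicalSpace M] [ChartedSpace E M] [IsManifold 𝓘(ℝ, E) ∞ M]
    (g : SemiRiemannianMetric E' N) (c : ℝ) (hc : HasConstantSectionalCurvature g c)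
    (f : M → N) (hf : IsLightlikeHypersurface (E := E) g f)
    (hO : IsPointwiseOsserman (E := E) g f)
    (S : Screen (E := E) g f) (hS : S.IsAdmissible) (hA : S.IsNonNullShape) :
    S.IsSemiSymmetric ↔ S.IsTotallyGeodesic := by
  obtain ⟨hB, hR⟩ := theorem5p3_general hc hf hS fun U ξ ν h u hu hmem =>
    hA U ξ ν h u hu (hmem _)
  exact iff_of_true hR hB
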